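/- **Setting.** Let $\Pi^+$ be the set of predicates generated from an identity predicate $\mathsf{id}$ and countably many propositional variables by the operations $A+B$ (union), $\overline A$ (complement), $A;B$ (relative product) and $A^{\smile}$ (converse). Put $A\cdot B=\overline{\overline A+\overline B}$ and define $$A\lor B=A+B,\quad A\land B=A\cdot B,\quad \neg A=\overline A,\quad {\sim}A=\overline{A^{\smile}},\quad A\to B=\overline{A^{\smile};\overline B},\quad A\circ B=B;A,\quad A^*=A^{\smile},\quad \mathbf t=\mathsf{id}.$$ Below, $\circ$ binds more strongly than $\land$, $\land$ more strongly than $\lor$, and $\lor$ more strongly than $\to$. An equation is a formal expression $A=B$ with $A,B\in\Pi^+$; $A\le B$ abbreviates $A+B=B$. *Density* is the set of all equations $A\le A;A$, *commutativity* the set of all $A;B=B;A$, *symmetry* the set of all $A=A^{\smile}$. **Sequent calculus.** An $n$-sequent $\Gamma\,|\,\Delta$ consists of two sets of formulas $xAy$ with $A\in\Pi^+$ and $x,y\in\{v_0,\dots,v_{n-1}\}$. Axioms are the $n$-sequents $\Gamma\,|\,\Delta$ with $\Gamma\cap\Delta\neq\emptyset$, or with some $x\,\mathsf{id}\,x\in\Delta$.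 The rules are (comma denotes union) - cut: from $\Gamma\,|\,\Delta,xAy$ and $xAy,\Gamma'\,|\,\Delta'$ infer $\Gamma,\Gamma'\,|\,\Delta,\Delta'$; - identity: from $xAy,\Gamma\,|\,\Delta$ infer $xAz,\,z\,\mathsf{id}\,y,\Gamma\,|\,\Delta$; - $+$: from $xAy,\Gamma\,|\,\Delta$ and $xBy,\Gamma'\,|\,\Delta'$ infer $x(A+B)y,\Gamma,\Gamma'\,|\,\Delta,\Delta'$; from $\Gamma\,|\,\Delta,xAy,xBy$ infer $\Gamma\,|\,\Delta,x(A+B)y$; - $\cdot$: from $xAy,xBy,\Gamma\,|\,\Delta$ infer $x(A\cdot B)y,\Gamma\,|\,\Delta$; from $\Gamma\,|\,\Delta,xAy$ and $\Gamma'\,|\,\Delta',xBy$ infer $\Gamma,\Gamma'\,|\,\Delta,\Delta',x(A\cdot B)y$; - complement: from $\Gamma\,|\,\Delta,xAy$ infer $x\overline Ay,\Gamma\,|\,\Delta$; from $xAy,\Gamma\,|\,\Delta$ infer $\Gamma\,|\,\Delta,x\overline Ay$; - relative product: from $xAy,yBz,\Gamma\,|\,\Delta$ infer $x(A;B)z,\Gamma\,|\,\Delta$,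 provided that $y\ne x$, $y\neq z$ and $y$ does not occur in $\Gamma,\Delta$; from $\Gamma\,|\,\Delta,xAy$ and $\Gamma'\,|\,\Delta',yBz$ infer $\Gamma,\Gamma'\,|\,\Delta,\Delta',x(A;B)z$; - converse: from $xAy,\Gamma\,|\,\Delta$ infer $yA^{\smile}x,\Gamma\,|\,\Delta$; from $\Gamma\,|\,\Delta,xAy$ infer $\Gamma\,|\,\Delta,yA^{\smile}x$. A predicate $A$ is $n$-*provable* if the $n$-sequent $|\,v_0Av_0$ is derivable by these rules, and $n$-*provable from* a set $\Psi$ of equations if it is so derivable when, for each $A'=B'$ in $\Psi$, the sequents $v_0A'v_1\,|\,v_0B'v_1$ and $v_0B'v_1\,|\,v_0A'v_1$ may be used as additional axioms. A rule $P_1,\dots,P_k\vdash Q$ is $n$-*provable* if $|\,v_0Qv_0$ is derivable, as an $n$-sequent, from $|\,v_0P_1v_0,\ \dots,\ |\,v_0P_kv_0$. **Logics.** Consider first-order formulas built from atomic formulas $xAy$ ($A\in\Pi^+$) and equations $A=B$ (with no free variables) by implication, negation and universal quantification. For $n\ge 3$ the standard $n$-variable formalism uses only formulas whose variables are all among $v_0,\dots,v_{n-1}$.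 Its axioms are the universal closures of - propositional axioms: $(\varphi\Rightarrow\psi)\Rightarrow((\psi\Rightarrow\xi)\Rightarrow(\varphi\Rightarrow\xi))$, $(\neg\varphi\Rightarrow\varphi)\Rightarrow\varphi$, $\varphi\Rightarrow(\neg\varphi\Rightarrow\psi)$; - quantifier axioms: $\forall x\forall y\varphi\Rightarrow\forall y\forall x\varphi$, $\forall x(\varphi\Rightarrow\psi)\Rightarrow(\forall x\varphi\Rightarrow\forall x\psi)$, $\forall x\varphi\Rightarrow\varphi$, and $\varphi\Rightarrow\forall x\varphi$ if $x$ is not free in $\varphi$; - equality axioms: $\exists x(x\,\mathsf{id}\,y)$ for $x\ne y$, and the general Leibniz law $x\,\mathsf{id}\,y\Rightarrow(\varphi\Rightarrow\varphi[x/y])$, where capture in the substitution is avoided by interchanging bound variables, so that no new variable is needed; - definitions of the operators: $v_0(A+B)v_1\Leftrightarrow v_0Av_1\lor v_0Bv_1$; $v_0\overline Av_1\Leftrightarrow\neg\,v_0Av_1$; $v_0(A;B)v_1\Leftrightarrow\exists v_2(v_0Av_2\land v_2Bv_1)$; $v_0A^{\smile}v_1\Leftrightarrow v_1Av_0$; $(A=B)\Leftrightarrow\forall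 v_0\forall v_1(v_0Av_1\Leftrightarrow v_0Bv_1)$. Modus ponens is the only rule of inference. (For $n=3$ there is no axiom of associativity of $;$.) For a set $\Psi$ of equations, $\mathrm{CT}^\Psi_n$ is the set of all $A\in\Pi^+$ such that $\mathsf{id}\le A$ is provable from $\Psi$ in the $n$-variable formalism. Put $\mathrm{CT}_n=\mathrm{CT}^{\emptyset}_n$, and let $\mathrm{TR}=\mathrm{CT}^\Psi_4$, where $\Psi$ is the union of density and commutativity. A rule $P_1,\dots,P_k\vdash Q$ is a *rule of* $\mathrm{CT}_n^\Psi$ if for all $\Psi'\supseteq\Psi$, $P_1,\dots,P_k\in\mathrm{CT}_n^{\Psi'}$ implies $Q\in\mathrm{CT}_n^{\Psi'}$. **Theorem.** Let $A,B,C,D\in\Pi^+$. 1. The following predicates are 1-provable: $\mathbf t$; $A\lor\neg A$; $A\lor{\sim}A$. 2. The following predicates are 2-provable: $A\to A$; $((A\to A)\to B)\to B$; $A\lor A\to A$; $A\to A\lor B$; $B\to A\lor B$; $A\lor B\to B\lor A$; $A\to A\land A$; $A\land B\to A$; $A\land B\to B$; $A\land B\to B\land A$; $(A\lor B)\lor C\to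 A\lor(B\lor C)$; $(A\land B)\land C\to A\land(B\land C)$; $(A\lor B)\land C\to(A\land C)\lor(B\land C)$; $(A\land B)\lor C\to(A\lor C)\land(B\lor C)$; ${\sim}{\sim}A\to A$; $A\to{\sim}{\sim}A$; ${\sim}(A\lor B)\to{\sim}A\land{\sim}B$; ${\sim}(A\land B)\to{\sim}A\lor{\sim}B$; ${\sim}A\land{\sim}B\to{\sim}(A\lor B)$; ${\sim}A\lor{\sim}B\to{\sim}(A\land B)$; $\neg\neg A\to A$; $A\to\neg\neg A$; $\neg(A\lor B)\to\neg A\land\neg B$; $\neg(A\land B)\to\neg A\lor\neg B$; $\neg A\land\neg B\to\neg(A\lor B)$; $\neg A\lor\neg B\to\neg(A\land B)$; $A\to B\lor\neg B$; $\neg A\land A\to B$. 3. The following predicates are 3-provable: $(A\to B)\land(A\to C)\to(A\to B\land C)$; $(A\to C)\land(B\to C)\to(A\lor B\to C)$; $(A\to B)\land(C\to D)\to(A\land C\to B\land D)$; $(A\to B)\land(C\to D)\to(A\lor C\to B\lor D)$; $(A\to B)\lor(C\to D)\to(A\land C\to B\lor D)$; $A\circ B\to{\sim}(A\to{\sim}B)$;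 ${\sim}(A\to{\sim}B)\to A\circ B$; $(A\to B)\circ A\to B$; $A\to(B\to A\circ B)$; $A\to((B\to{\sim}A)\to{\sim}B)$; $A\circ B\land C\to A\circ(B\land{\sim}D)\lor(A\land C\circ D)\circ B$; $A\circ B\land C\to(A\land{\sim}D)\circ B\lor A\circ(B\land D\circ C)$; $A\circ B\land C\to(A\land C\circ B^*)\circ(B\land A^*\circ C)$; $\mathbf t\circ A\to A$; $A\circ\mathbf t\to A$; $A\to A\circ\mathbf t^*$; $\mathbf t\to\mathbf t^*$; $\mathbf t^*\to\mathbf t$; $\mathbf t\land{\sim}\mathbf t\to A$. 4. The following rules are 1-provable: $A,B\vdash A\land B$; $A\to B,A\vdash B$; $A\lor B,{\sim}A\vdash B$; $A\vdash A^*$. 5. The following rules are 2-provable: $A\to B,B\to C\vdash A\to C$; $A\to B\vdash{\sim}B\to{\sim}A$; $A\to{\sim}B\vdash B\to{\sim}A$; $A\land B\to C,\ B\to C\lor A\vdash B\to C$; $A\vdash(A\to B)\to B$; $A\land B\to\neg C\vdash A\land C\to\neg B$; $B\land\neg C\to A\land\neg A\vdash B\to C$; $B\land C^*\to A\land\neg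 A\vdash B\to{\sim}C$. 6. The following rules are 3-provable: $A\to B\vdash(B\to C)\to(A\to C)$; $A\to B\vdash(C\to A)\to(C\to B)$; $A\to B,C\to D\vdash(B\to C)\to(A\to D)$; $A\to B,C\to D\vdash A\circ C\to B\circ D$; $A\to(B\to C)\vdash B\to({\sim}C\to{\sim}A)$. 7. The following predicates are 4-provable: $(A\to B)\to((C\to A)\to(C\to B))$; $(A\to(B\to C))\to(A\circ B\to C)$; $(A\circ B\to C)\to(A\to(B\to C))$; $(A\to B)\to(A\circ C\to B\circ C)$; $(A\circ B)\circ C\to A\circ(B\circ C)$; $A\circ(B\circ C)\to(A\circ B)\circ C$. 8. The following predicates are 3-provable from density: $(A\to{\sim}A)\to{\sim}A$; $A\land B\to A\circ B$; $(A\to B)\to{\sim}A\lor B$. 9. The following predicates are 4-provable from density: $(A\to(A\to B))\to(A\to B)$; $(A\to(B\to C))\to(A\land B\to C)$. 10. The following predicates are 3-provable from commutativity: $A\to((A\to B)\to B)$; $(A\to{\sim}B)\to(B\to{\sim}A)$. 11. The following predicates are 4-provable from commutativity: $(A\to(B\to C))\to(B\to(A\to C))$; $(A\to B)\to((B\to C)\to(A\to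 C))$. 12. $(A\to(B\to C))\to((A\to B)\to(A\to C))$ is 4-provable from density and commutativity together. 13. $A\land{\sim}A\to B$ is 2-provable from symmetry. 14. $A\circ B\to B\circ A$ is 3-provable from symmetry. 15. $\mathrm{CT}_3$ contains all predicates in (1)–(3); $\mathrm{CT}_4$ contains all predicates in (1)–(3) and (7); $\mathrm{TR}$ contains all predicates in (1)–(3) and (7)–(12). All the rules in (4)–(6) are rules of $\mathrm{CT}_3$, of $\mathrm{CT}_4$ and of $\mathrm{TR}$. -/

import Mathlib

namespace RelLogic

/-! ### Predicates and equations -/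

/-- The predicates: generated from the identity predicate `id` and countably many propositional
variables `var k` by union, complement, relative product and converse. -/
inductive Pred : Type
  | id : Pred
  | var (k : ℕ) : Pred
  | add (A B : Pred) : Pred
  | compl (A : Pred) : Pred
  | rp (A B : Pred) : Pred
  | conv (A : Pred) : Pred

namespace Pred

/-- Boolean product, the complement of the sum of the complements. -/
def mul (A B : Pred) : Pred := compl (add (compl A) (compl B))

/-- disjunction -/
def or (A B : Pred) : Pred := add A B
/-- conjunction -/
def and (A B : Pred) : Pred := mul A B
/-- Boolean negation -/
def bneg (A : Pred) : Pred := compl A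
/-- De Morgan negation -/
def dneg (A : Pred) : Pred := compl (conv A)
/-- relevant implication, the complement of `conv A ; compl B` -/
def impl (A B : Pred) : Pred := compl (rp (conv A) (compl B))
/-- fusion, the reversed relative product -/
def fus (A B : Pred) : Pred := rp B A
/-- Routley star -/
def star (A : Pred) : Pred := conv A
/-- truth -/
def t : Pred := id

end Pred

/-- An equation between predicates. -/
structure Equation : Type where
  lhs : Pred
  rhs : Pred

/-- The inclusion `A ≤ B`, that is, the equation `A + B = B`. -/
def incl (A B : Pred) : Equation := ⟨Pred.add A B, B⟩

/-- The equations of density, `A ≤ A ; A`. -/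
def density : Set Equation := {e | ∃ A : Pred, e = incl A (Pred.rp A A)}

/-- The equations of commutativity, `A ; B = B ; A`. -/
def commutativity : Set Equation := {e | ∃ A B : Pred, e = ⟨Pred.rp A B, Pred.rp B A⟩}

/-- The equations of symmetry, `A = conv A`. -/
def symmetry : Set Equation := {e | ∃ A : Pred, e = ⟨A, Pred.conv A⟩}

/-! ### First-order logic of binary relations with finitely many variables -/

/-- Formulas of the first-order logic of binary relations, extended by operators on predicates and
by equations. The variables are indexed by the natural numbers. -/
inductive Formula : Type
  | rel (x : ℕ) (A : Pred) (y : ℕ) : Formula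
  | eqn (e : Equation) : Formula
  | imp (φ ψ : Formula) : Formula
  | neg (φ : Formula) : Formula
  | all (x : ℕ) (φ : Formula) : Formula

namespace Formula

def or (φ ψ : Formula) : Formula := imp (neg φ) ψ
def and (φ ψ : Formula) : Formula := neg (imp φ (neg ψ))
def iff (φ ψ : Formula) : Formula := neg (imp (imp φ ψ) (neg (imp ψ φ)))
def ex (x : ℕ) (φ : Formula) : Formula := neg (all x (neg φ))

/-- The free variables of a formula. -/
def freeVars : Formula → Finset ℕ
  | rel x _ y => {x, y}
  | eqn _ => ∅
  | imp φ ψ => φ.freeVars ∪ ψ.freeVars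
  | neg φ => φ.freeVars
  | all x φ => φ.freeVars.erase x

/-- All variables of the formula, free or bound, have an index less than `n`. -/
def VarsBelow (n : ℕ) : Formula → Prop
  | rel x _ y => x < n ∧ y < n
  | eqn _ => True
  | imp φ ψ => φ.VarsBelow n ∧ ψ.VarsBelow n
  | neg φ => φ.VarsBelow n
  | all x φ => x < n ∧ φ.VarsBelow n

/-- The closure of a formula: universal quantification over all free variables, where the
quantifier of the last free variable is the innermost one. -/
def closure (φ : Formula) : Formula := (φ.freeVars.sort (· ≤ ·)).foldr all φ

/-- Interchange of the variables `x` and `y` throughout a formula. -/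
def switch (x y : ℕ) : Formula → Formula
  | rel u A v => rel (Equiv.swap x y u) A (Equiv.swap x y v)
  | eqn e => eqn e
  | imp φ ψ => imp (φ.switch x y) (ψ.switch x y)
  | neg φ => neg (φ.switch x y)
  | all z φ => all (Equiv.swap x y z) (φ.switch x y)

/-- Substitution of `y` for the free occurrences of `x` which introduces no further variable: in
front of a quantifier that would capture `y`, the variables `x` and `y` are interchanged. -/
def subst (x y : ℕ) : Formula → Formula
  | rel u A v => rel (if u = x then y else u) A (if v = x then y else v)
  | eqn e => eqn e
  | imp φ ψ => imp (φ.subst x y) (ψ.subst x y)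
  | neg φ => neg (φ.subst x y)
  | all z φ =>
      if z = x then all x φ
      else if z = y then all x (φ.switch x y)
      else all z (φ.subst x y)

end Formula

open Formula in
/-- The basic logical sentences: closures of schemes for propositional logic, quantifiers and
equality (with the general Leibniz law), and the definitions of the operators on predicates. -/
inductive IsBasic : Formula → Prop
  | syll (φ ψ ξ : Formula) :
      IsBasic (closure (imp (imp φ ψ) (imp (imp ψ ξ) (imp φ ξ))))
  | clavius (φ : Formula) : IsBasic (closure (imp (imp (neg φ) φ) φ))
  | scotus (φ ψ : Formula) : IsBasic (closure (imp φ (imp (neg φ) ψ)))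
  | all_comm (x y : ℕ) (φ : Formula) :
      IsBasic (closure (imp (all x (all y φ)) (all y (all x φ))))
  | all_imp (x : ℕ) (φ ψ : Formula) :
      IsBasic (closure (imp (all x (imp φ ψ)) (imp (all x φ) (all x ψ))))
  | all_elim (x : ℕ) (φ : Formula) : IsBasic (closure (imp (all x φ) φ))
  | all_vacuous (x : ℕ) (φ : Formula) (h : x ∉ φ.freeVars) :
      IsBasic (closure (imp φ (all x φ)))
  | ex_eq (x y : ℕ) (h : x ≠ y) : IsBasic (closure (ex x (rel x Pred.id y)))
  | leibniz (x y : ℕ) (φ : Formula) :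
      IsBasic (closure (imp (rel x Pred.id y) (imp φ (φ.subst x y))))
  | def_add (A B : Pred) :
      IsBasic (closure (iff (rel 0 (Pred.add A B) 1) (or (rel 0 A 1) (rel 0 B 1))))
  | def_compl (A : Pred) :
      IsBasic (closure (iff (rel 0 (Pred.compl A) 1) (neg (rel 0 A 1))))
  | def_rp (A B : Pred) :
      IsBasic (closure (iff (rel 0 (Pred.rp A B) 1) (ex 2 (and (rel 0 A 2) (rel 2 B 1)))))
  | def_conv (A : Pred) :
      IsBasic (closure (iff (rel 0 (Pred.conv A) 1) (rel 1 A 0)))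
  | def_eqn (A B : Pred) :
      IsBasic (iff (eqn ⟨A, B⟩) (closure (iff (rel 0 A 1) (rel 0 B 1))))

/-- Provability of a sentence from a set of equations in the standard formalism with `n` variables
(`3 ≤ n`): the basic sentences are those in which only the first `n` variables occur, and modus
ponens is the only rule. For `n = 3` this is the standardized three-variable formalism, in which
associativity of the relative product is not assumed. -/
inductive FOProvable (n : ℕ) (Ψ : Set Equation) : Formula → Prop
  | hyp (e : Equation) (h : e ∈ Ψ) : FOProvable n Ψ (Formula.eqn e)
  | basic (φ : Formula) (h : IsBasic φ) (hn : φ.VarsBelow n) : FOProvable n Ψ φ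
  | mp (φ ψ : Formula) (h₁ : FOProvable n Ψ (Formula.imp φ ψ)) (h₂ : FOProvable n Ψ φ) :
      FOProvable n Ψ ψ

/-- The classical relevant logic with `n` variables (`3 ≤ n`) and the set `Ψ` of non-logical
assumptions: all predicates `A` such that `id ≤ A` is provable from `Ψ` with `n` variables. -/
def CT (n : ℕ) (Ψ : Set Equation) : Set Pred :=
  {A | FOProvable n Ψ (Formula.eqn (incl Pred.id A))}

/-- The non-logical assumptions of Tarski's classical relevant logic. -/
def assumptionsTR : Set Equation := density ∪ commutativity

/-- Tarski's classical relevant logic. -/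
def TR : Set Pred := CT 4 assumptionsTR

/-- A rule of inference, from finitely many premises to a conclusion. -/
structure Rule : Type where
  premises : List Pred
  conclusion : Pred

/-- A rule is a (derived) rule of the logic `CT n Ψ` if that logic, and every logic obtained from
it by adding non-logical assumptions, such as `id ≤ P` for the premises `P` of the rule, contains
the conclusion whenever it contains the premises. -/
def IsRuleOf (n : ℕ) (Ψ : Set Equation) (r : Rule) : Prop :=
  ∀ Ψ' : Set Equation, Ψ ⊆ Ψ' → (∀ P ∈ r.premises, P ∈ CT n Ψ') → r.conclusion ∈ CT n Ψ'

/-! ### The sequent calculus with finitely many variables -/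

/-- The formula `x A y`, where `x` and `y` are among the first `n` variables. -/
abbrev Atom (n : ℕ) : Type := Fin n × Pred × Fin n

/-- An `n`-sequent: a pair of (possibly infinite) sets of formulas `x A y`. -/
structure Sequent (n : ℕ) : Type where
  left : Set (Atom n)
  right : Set (Atom n)

/-- The variable `v` occurs in no formula of the set `Γ`. -/
def NotIn {n : ℕ} (v : Fin n) (Γ : Set (Atom n)) : Prop :=
  ∀ a ∈ Γ, a.1 ≠ v ∧ a.2.2 ≠ v

/-- Provability of the sequent with sides `Γ` and `Δ` from the set `Ψ` of sequents in the sequent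
calculus with `n` variables. -/
inductive SeqProvable {n : ℕ} (Ψ : Set (Sequent n)) : Set (Atom n) → Set (Atom n) → Prop
  | hyp (s : Sequent n) (h : s ∈ Ψ) : SeqProvable Ψ s.left s.right
  | ax (a : Atom n) (Γ Δ : Set (Atom n)) (h : a ∈ Γ) (h' : a ∈ Δ) : SeqProvable Ψ Γ Δ
  | id_right (x : Fin n) (Γ Δ : Set (Atom n)) (h : (x, Pred.id, x) ∈ Δ) : SeqProvable Ψ Γ Δ
  | cut (a : Atom n) (Γ Δ Γ' Δ' : Set (Atom n))
      (h₁ : SeqProvable Ψ Γ (insert a Δ)) (h₂ : SeqProvable Ψ (insert a Γ') Δ') :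
      SeqProvable Ψ (Γ ∪ Γ') (Δ ∪ Δ')
  | id_left (x y z : Fin n) (A : Pred) (Γ Δ : Set (Atom n))
      (h : SeqProvable Ψ (insert (x, A, y) Γ) Δ) :
      SeqProvable Ψ (insert (x, A, z) (insert (z, Pred.id, y) Γ)) Δ
  | add_left (x y : Fin n) (A B : Pred) (Γ Δ Γ' Δ' : Set (Atom n))
      (h₁ : SeqProvable Ψ (insert (x, A, y) Γ) Δ) (h₂ : SeqProvable Ψ (insert (x, B, y) Γ') Δ') :
      SeqProvable Ψ (insert (x, Pred.add A B, y) (Γ ∪ Γ')) (Δ ∪ Δ')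
  | add_right (x y : Fin n) (A B : Pred) (Γ Δ : Set (Atom n))
      (h : SeqProvable Ψ Γ (insert (x, A, y) (insert (x, B, y) Δ))) :
      SeqProvable Ψ Γ (insert (x, Pred.add A B, y) Δ)
  | mul_left (x y : Fin n) (A B : Pred) (Γ Δ : Set (Atom n))
      (h : SeqProvable Ψ (insert (x, A, y) (insert (x, B, y) Γ)) Δ) :
      SeqProvable Ψ (insert (x, Pred.mul A B, y) Γ) Δ
  | mul_right (x y : Fin n) (A B : Pred) (Γ Δ Γ' Δ' : Set (Atom n))
      (h₁ : SeqProvable Ψ Γ (insert (x, A, y) Δ)) (h₂ : SeqProvable Ψ Γ' (insert (x, B, y) Δ')) :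
      SeqProvable Ψ (Γ ∪ Γ') (insert (x, Pred.mul A B, y) (Δ ∪ Δ'))
  | compl_left (x y : Fin n) (A : Pred) (Γ Δ : Set (Atom n))
      (h : SeqProvable Ψ Γ (insert (x, A, y) Δ)) :
      SeqProvable Ψ (insert (x, Pred.compl A, y) Γ) Δ
  | compl_right (x y : Fin n) (A : Pred) (Γ Δ : Set (Atom n))
      (h : SeqProvable Ψ (insert (x, A, y) Γ) Δ) :
      SeqProvable Ψ Γ (insert (x, Pred.compl A, y) Δ)
  | rp_left (x y z : Fin n) (A B : Pred) (Γ Δ : Set (Atom n))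
      (hx : y ≠ x) (hz : y ≠ z) (hΓ : NotIn y Γ) (hΔ : NotIn y Δ)
      (h : SeqProvable Ψ (insert (x, A, y) (insert (y, B, z) Γ)) Δ) :
      SeqProvable Ψ (insert (x, Pred.rp A B, z) Γ) Δ
  | rp_right (x y z : Fin n) (A B : Pred) (Γ Δ Γ' Δ' : Set (Atom n))
      (h₁ : SeqProvable Ψ Γ (insert (x, A, y) Δ)) (h₂ : SeqProvable Ψ Γ' (insert (y, B, z) Δ')) :
      SeqProvable Ψ (Γ ∪ Γ') (insert (x, Pred.rp A B, z) (Δ ∪ Δ'))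
  | conv_left (x y : Fin n) (A : Pred) (Γ Δ : Set (Atom n))
      (h : SeqProvable Ψ (insert (x, A, y) Γ) Δ) :
      SeqProvable Ψ (insert (y, Pred.conv A, x) Γ) Δ
  | conv_right (x y : Fin n) (A : Pred) (Γ Δ : Set (Atom n))
      (h : SeqProvable Ψ Γ (insert (x, A, y) Δ)) :
      SeqProvable Ψ Γ (insert (y, Pred.conv A, x) Δ)

/-- The sequent with empty left side and right side `0 A 0`. -/
def assertion (n : ℕ) [NeZero n] (A : Pred) : Sequent n := ⟨∅, {(0, A, 0)}⟩

/-- The sequents corresponding to a set of equations (`2 ≤ n`): for each equation `A = B`, the two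
sequents between `0 A 1` and `0 B 1`. -/
def sequentsOf (n : ℕ) [NeZero n] (Ψ : Set Equation) : Set (Sequent n) :=
  {s | ∃ e ∈ Ψ, s = ⟨{(0, e.lhs, 1)}, {(0, e.rhs, 1)}⟩ ∨ s = ⟨{(0, e.rhs, 1)}, {(0, e.lhs, 1)}⟩}

/-- The predicate `A` is `n`-provable. -/
def NProvable (n : ℕ) [NeZero n] (A : Pred) : Prop :=
  SeqProvable (∅ : Set (Sequent n)) (assertion n A).left (assertion n A).right

/-- The predicate `A` is `n`-provable from the equations in `Ψ`. -/
def NProvableFrom (n : ℕ) [NeZero n] (Ψ : Set Equation) (A : Pred) : Prop :=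
  SeqProvable (sequentsOf n Ψ) (assertion n A).left (assertion n A).right

/-- A rule is `n`-provable: proofs of its premises, from whatever assumptions, can be extended to a
proof of its conclusion by an `n`-proof. -/
def RuleNProvable (n : ℕ) [NeZero n] (r : Rule) : Prop :=
  SeqProvable {s | ∃ P ∈ r.premises, s = assertion n P}
    (assertion n r.conclusion).left (assertion n r.conclusion).right

/-! ### The predicates and rules -/

prefix:max "⌐" => Pred.bneg
prefix:max "∼" => Pred.dneg
postfix:max "⁎" => Pred.star
infixl:75 " ⊚ " => Pred.fus
infixl:70 " ⋏ " => Pred.and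
infixl:65 " ⋎ " => Pred.or
infixl:60 " ⇾ " => Pred.impl

/-- predicates to be proved with one variable -/
def preds1 (A : Pred) : List Pred :=
  [ Pred.t,
    A ⋎ ⌐A,
    A ⋎ ∼A ]

/-- predicates to be proved with two variables -/
def preds2 (A B C : Pred) : List Pred :=
  [ A ⇾ A,
    ((A ⇾ A) ⇾ B) ⇾ B,
    A ⋎ A ⇾ A,
    A ⇾ A ⋎ B,
    B ⇾ A ⋎ B,
    A ⋎ B ⇾ B ⋎ A,
    A ⇾ A ⋏ A,
    A ⋏ B ⇾ A,
    A ⋏ B ⇾ B,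
    A ⋏ B ⇾ B ⋏ A,
    (A ⋎ B) ⋎ C ⇾ A ⋎ (B ⋎ C),
    (A ⋏ B) ⋏ C ⇾ A ⋏ (B ⋏ C),
    (A ⋎ B) ⋏ C ⇾ (A ⋏ C) ⋎ (B ⋏ C),
    (A ⋏ B) ⋎ C ⇾ (A ⋎ C) ⋏ (B ⋎ C),
    ∼(∼A) ⇾ A,
    A ⇾ ∼(∼A),
    ∼(A ⋎ B) ⇾ ∼A ⋏ ∼B,
    ∼(A ⋏ B) ⇾ ∼A ⋎ ∼B,
    ∼A ⋏ ∼B ⇾ ∼(A ⋎ B),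
    ∼A ⋎ ∼B ⇾ ∼(A ⋏ B),
    ⌐(⌐A) ⇾ A,
    A ⇾ ⌐(⌐A),
    ⌐(A ⋎ B) ⇾ ⌐A ⋏ ⌐B,
    ⌐(A ⋏ B) ⇾ ⌐A ⋎ ⌐B,
    ⌐A ⋏ ⌐B ⇾ ⌐(A ⋎ B),
    ⌐A ⋎ ⌐B ⇾ ⌐(A ⋏ B),
    A ⇾ B ⋎ ⌐B,
    ⌐A ⋏ A ⇾ B ]

/-- predicates to be proved with three variables -/
def preds3 (A B C D : Pred) : List Pred :=
  [ (A ⇾ B) ⋏ (A ⇾ C) ⇾ (A ⇾ B ⋏ C),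
    (A ⇾ C) ⋏ (B ⇾ C) ⇾ (A ⋎ B ⇾ C),
    (A ⇾ B) ⋏ (C ⇾ D) ⇾ (A ⋏ C ⇾ B ⋏ D),
    (A ⇾ B) ⋏ (C ⇾ D) ⇾ (A ⋎ C ⇾ B ⋎ D),
    (A ⇾ B) ⋎ (C ⇾ D) ⇾ (A ⋏ C ⇾ B ⋎ D),
    A ⊚ B ⇾ ∼(A ⇾ ∼B),
    ∼(A ⇾ ∼B) ⇾ A ⊚ B,
    (A ⇾ B) ⊚ A ⇾ B,
    A ⇾ (B ⇾ A ⊚ B),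
    A ⇾ ((B ⇾ ∼A) ⇾ ∼B),
    (A ⊚ B) ⋏ C ⇾ (A ⊚ (B ⋏ ∼D)) ⋎ ((A ⋏ (C ⊚ D)) ⊚ B),
    (A ⊚ B) ⋏ C ⇾ ((A ⋏ ∼D) ⊚ B) ⋎ (A ⊚ (B ⋏ (D ⊚ C))),
    (A ⊚ B) ⋏ C ⇾ (A ⋏ (C ⊚ B⁎)) ⊚ (B ⋏ (A⁎ ⊚ C)),
    Pred.t ⊚ A ⇾ A,
    A ⊚ Pred.t ⇾ A,
    A ⇾ A ⊚ Pred.t⁎,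
    Pred.t ⇾ Pred.t⁎,
    Pred.t⁎ ⇾ Pred.t,
    Pred.t ⋏ ∼Pred.t ⇾ A ]

/-- rules to be proved with one variable -/
def rules1 (A B : Pred) : List Rule :=
  [ ⟨[A, B], A ⋏ B⟩,
    ⟨[A ⇾ B, A], B⟩,
    ⟨[A ⋎ B, ∼A], B⟩,
    ⟨[A], A⁎⟩ ]

/-- rules to be proved with two variables -/
def rules2 (A B C : Pred) : List Rule :=
  [ ⟨[A ⇾ B, B ⇾ C], A ⇾ C⟩,
    ⟨[A ⇾ B], ∼B ⇾ ∼A⟩,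
    ⟨[A ⇾ ∼B], B ⇾ ∼A⟩,
    ⟨[A ⋏ B ⇾ C, B ⇾ C ⋎ A], B ⇾ C⟩,
    ⟨[A], (A ⇾ B) ⇾ B⟩,
    ⟨[A ⋏ B ⇾ ⌐C], A ⋏ C ⇾ ⌐B⟩,
    ⟨[B ⋏ ⌐C ⇾ A ⋏ ⌐A], B ⇾ C⟩,
    ⟨[B ⋏ C⁎ ⇾ A ⋏ ⌐A], B ⇾ ∼C⟩ ]

/-- rules to be proved with three variables -/
def rules3 (A B C D : Pred) : List Rule :=
  [ ⟨[A ⇾ B], (B ⇾ C) ⇾ (A ⇾ C)⟩,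
    ⟨[A ⇾ B], (C ⇾ A) ⇾ (C ⇾ B)⟩,
    ⟨[A ⇾ B, C ⇾ D], (B ⇾ C) ⇾ (A ⇾ D)⟩,
    ⟨[A ⇾ B, C ⇾ D], A ⊚ C ⇾ B ⊚ D⟩,
    ⟨[A ⇾ (B ⇾ C)], B ⇾ (∼C ⇾ ∼A)⟩ ]

/-- predicates to be proved with four variables -/
def preds4 (A B C : Pred) : List Pred :=
  [ (A ⇾ B) ⇾ ((C ⇾ A) ⇾ (C ⇾ B)),
    (A ⇾ (B ⇾ C)) ⇾ (A ⊚ B ⇾ C),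
    (A ⊚ B ⇾ C) ⇾ (A ⇾ (B ⇾ C)),
    (A ⇾ B) ⇾ (A ⊚ C ⇾ B ⊚ C),
    (A ⊚ B) ⊚ C ⇾ A ⊚ (B ⊚ C),
    A ⊚ (B ⊚ C) ⇾ (A ⊚ B) ⊚ C ]

/-- predicates to be proved with three variables from density -/
def predsDensity3 (A B : Pred) : List Pred :=
  [ (A ⇾ ∼A) ⇾ ∼A,
    A ⋏ B ⇾ A ⊚ B,
    (A ⇾ B) ⇾ ∼A ⋎ B ]

/-- predicates to be proved with four variables from density -/
def predsDensity4 (A B C : Pred) : List Pred :=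
  [ (A ⇾ (A ⇾ B)) ⇾ (A ⇾ B),
    (A ⇾ (B ⇾ C)) ⇾ (A ⋏ B ⇾ C) ]

/-- predicates to be proved with three variables from commutativity -/
def predsComm3 (A B : Pred) : List Pred :=
  [ A ⇾ ((A ⇾ B) ⇾ B),
    (A ⇾ ∼B) ⇾ (B ⇾ ∼A) ]

/-- predicates to be proved with four variables from commutativity -/
def predsComm4 (A B C : Pred) : List Pred :=
  [ (A ⇾ (B ⇾ C)) ⇾ (B ⇾ (A ⇾ C)),
    (A ⇾ B) ⇾ ((B ⇾ C) ⇾ (A ⇾ C)) ]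

/-- self-distribution -/
def selfDist (A B C : Pred) : Pred :=
  (A ⇾ (B ⇾ C)) ⇾ ((A ⇾ B) ⇾ (A ⇾ C))

/-- the predicates proved without non-logical assumptions with at most three variables -/
def predsCT3 (A B C D : Pred) : List Pred :=
  preds1 A ++ preds2 A B C ++ preds3 A B C D

/-- all the rules -/
def allRules (A B C D : Pred) : List Rule :=
  rules1 A B ++ rules2 A B C ++ rules3 A B C D

/-- the predicates proved from density, from commutativity, or from both -/
def predsTR (A B C : Pred) : List Pred :=
  predsDensity3 A B ++ predsDensity4 A B C ++ predsComm3 A B ++ predsComm4 A B C ++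
    [selfDist A B C]

end RelLogic

open RelLogic

namespace RelLogic

/-! ### Derivability under arbitrary weakening -/

/-- Every weakening of the sequent with sides `Γ` and `Δ` is provable. -/
def Derivable {n : ℕ} (Ψ : Set (Sequent n)) (Γ Δ : Set (Atom n)) : Prop :=
  ∀ Γ' Δ', Γ ⊆ Γ' → Δ ⊆ Δ' → SeqProvable Ψ Γ' Δ'

section Derivable

variable {n : ℕ} {Ψ : Set (Sequent n)} {Γ Δ Γ' Δ' : Set (Atom n)} {x y z : Fin n} {A B : Pred}

theorem Derivable.provable (h : Derivable Ψ Γ Δ) : SeqProvable Ψ Γ Δ :=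
  h _ _ subset_rfl subset_rfl

theorem Derivable.mono (h : Derivable Ψ Γ Δ) (hΓ : Γ ⊆ Γ') (hΔ : Δ ⊆ Δ') : Derivable Ψ Γ' Δ' :=
  fun _ _ h₁ h₂ => h _ _ (hΓ.trans h₁) (hΔ.trans h₂)

/-- The calculus has no weakening rule, but its axioms have arbitrary sides. A cut on a formula
already present, against such an axiom, adds whatever is wanted. -/
theorem SeqProvable.derivable_of_mem_left {a : Atom n} (h : SeqProvable Ψ Γ Δ) (ha : a ∈ Γ) :
    Derivable Ψ Γ Δ := by
  intro Γ' Δ' h₁ h₂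
  have := SeqProvable.cut a Γ' Δ' Γ Δ (.ax a _ _ (h₁ ha) (Set.mem_insert _ _))
    (by rwa [Set.insert_eq_of_mem ha])
  rwa [Set.union_eq_self_of_subset_right h₁, Set.union_eq_self_of_subset_right h₂] at this

theorem SeqProvable.derivable_of_mem_right {a : Atom n} (h : SeqProvable Ψ Γ Δ) (ha : a ∈ Δ) :
    Derivable Ψ Γ Δ := by
  intro Γ' Δ' h₁ h₂
  have := SeqProvable.cut a Γ Δ Γ' Δ' (by rwa [Set.insert_eq_of_mem ha])
    (.ax a _ _ (Set.mem_insert _ _) (h₂ ha))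
  rwa [Set.union_eq_self_of_subset_left h₁, Set.union_eq_self_of_subset_left h₂] at this

namespace Derivable

theorem ax (a : Atom n) (h : a ∈ Γ) (h' : a ∈ Δ) : Derivable Ψ Γ Δ :=
  fun _ _ h₁ h₂ => .ax a _ _ (h₁ h) (h₂ h')

theorem id_right (x : Fin n) (h : (x, Pred.id, x) ∈ Δ) : Derivable Ψ Γ Δ :=
  fun _ _ _ h₂ => .id_right x _ _ (h₂ h)

theorem cut (a : Atom n) (h₁ : Derivable Ψ Γ (insert a Δ)) (h₂ : Derivable Ψ (insert a Γ) Δ) :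
    Derivable Ψ Γ Δ := by
  intro Γ' Δ' hΓ hΔ
  simpa using SeqProvable.cut a Γ' Δ' Γ' Δ' (h₁ _ _ hΓ (Set.insert_subset_insert hΔ))
    (h₂ _ _ (Set.insert_subset_insert hΓ) hΔ)

theorem add_left (h₁ : Derivable Ψ (insert (x, A, y) Γ) Δ)
    (h₂ : Derivable Ψ (insert (x, B, y) Γ) Δ) :
    Derivable Ψ (insert (x, Pred.add A B, y) Γ) Δ := by
  intro Γ' Δ' hΓ hΔ
  obtain ⟨ha, hΓ⟩ := Set.insert_subset_iff.1 hΓ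
  have := SeqProvable.add_left x y A B Γ' Δ' Γ' Δ'
    (h₁ _ _ (Set.insert_subset_insert hΓ) hΔ) (h₂ _ _ (Set.insert_subset_insert hΓ) hΔ)
  simpa [Set.insert_eq_of_mem ha] using this

theorem add_right (h : Derivable Ψ Γ (insert (x, A, y) (insert (x, B, y) Δ))) :
    Derivable Ψ Γ (insert (x, Pred.add A B, y) Δ) := by
  intro Γ' Δ' hΓ hΔ
  obtain ⟨ha, hΔ⟩ := Set.insert_subset_iff.1 hΔ
  have := SeqProvable.add_right x y A B Γ' Δ'
    (h _ _ hΓ (Set.insert_subset_insert (Set.insert_subset_insert hΔ)))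
  rwa [Set.insert_eq_of_mem ha] at this

theorem compl_left (h : Derivable Ψ Γ (insert (x, A, y) Δ)) :
    Derivable Ψ (insert (x, Pred.compl A, y) Γ) Δ := by
  intro Γ' Δ' hΓ hΔ
  obtain ⟨ha, hΓ⟩ := Set.insert_subset_iff.1 hΓ
  have := SeqProvable.compl_left x y A Γ' Δ' (h _ _ hΓ (Set.insert_subset_insert hΔ))
  rwa [Set.insert_eq_of_mem ha] at this

theorem compl_right (h : Derivable Ψ (insert (x, A, y) Γ) Δ) :
    Derivable Ψ Γ (insert (x, Pred.compl A, y) Δ) := by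
  intro Γ' Δ' hΓ hΔ
  obtain ⟨ha, hΔ⟩ := Set.insert_subset_iff.1 hΔ
  have := SeqProvable.compl_right x y A Γ' Δ' (h _ _ (Set.insert_subset_insert hΓ) hΔ)
  rwa [Set.insert_eq_of_mem ha] at this

theorem conv_left (h : Derivable Ψ (insert (x, A, y) Γ) Δ) :
    Derivable Ψ (insert (y, Pred.conv A, x) Γ) Δ := by
  intro Γ' Δ' hΓ hΔ
  obtain ⟨ha, hΓ⟩ := Set.insert_subset_iff.1 hΓ
  have := SeqProvable.conv_left x y A Γ' Δ' (h _ _ (Set.insert_subset_insert hΓ) hΔ)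
  rwa [Set.insert_eq_of_mem ha] at this

theorem conv_right (h : Derivable Ψ Γ (insert (x, A, y) Δ)) :
    Derivable Ψ Γ (insert (y, Pred.conv A, x) Δ) := by
  intro Γ' Δ' hΓ hΔ
  obtain ⟨ha, hΔ⟩ := Set.insert_subset_iff.1 hΔ
  have := SeqProvable.conv_right x y A Γ' Δ' (h _ _ hΓ (Set.insert_subset_insert hΔ))
  rwa [Set.insert_eq_of_mem ha] at this

/-- The condition on `y` forbids weakening the premise, so the conclusion is weakened instead; its
principal formula is available for the cut. -/
theorem rp_left (y : Fin n) (hx : y ≠ x) (hz : y ≠ z) (hΓ : NotIn y Γ) (hΔ : NotIn y Δ)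
    (h : Derivable Ψ (insert (x, A, y) (insert (y, B, z) Γ)) Δ) :
    Derivable Ψ (insert (x, Pred.rp A B, z) Γ) Δ :=
  (SeqProvable.rp_left x y z A B Γ Δ hx hz hΓ hΔ h.provable).derivable_of_mem_left
    (Set.mem_insert _ _)

theorem rp_right (y : Fin n) (h₁ : Derivable Ψ Γ (insert (x, A, y) Δ))
    (h₂ : Derivable Ψ Γ (insert (y, B, z) Δ)) :
    Derivable Ψ Γ (insert (x, Pred.rp A B, z) Δ) := by
  intro Γ' Δ' hΓ hΔ
  obtain ⟨ha, hΔ⟩ := Set.insert_subset_iff.1 hΔ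
  have := SeqProvable.rp_right x y z A B Γ' Δ' Γ' Δ'
    (h₁ _ _ hΓ (Set.insert_subset_insert hΔ)) (h₂ _ _ hΓ (Set.insert_subset_insert hΔ))
  simpa [Set.insert_eq_of_mem ha] using this

theorem id_snd (h₁ : (x, A, y) ∈ Γ) (h₂ : (y, Pred.id, z) ∈ Γ) (h₃ : (x, A, z) ∈ Δ) :
    Derivable Ψ Γ Δ :=
  (SeqProvable.id_left x z y A ∅ {(x, A, z)}
    (.ax (x, A, z) _ _ (by simp) (by simp))).derivable_of_mem_left (Set.mem_insert _ _) |>.mono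
      (by simp [Set.insert_subset_iff, h₁, h₂]) (by simpa)

/-- The identity rule only rewrites second variables; passing to the converse exchanges the two
places. -/
theorem id_fst (h₁ : (x, A, y) ∈ Γ) (h₂ : (x, Pred.id, z) ∈ Γ) (h₃ : (z, A, y) ∈ Δ) :
    Derivable Ψ Γ Δ := by
  apply cut (y, Pred.conv A, x)
  · exact conv_right (ax (x, A, y) h₁ (by simp))
  apply cut (y, Pred.conv A, z)
  · exact id_snd (Set.mem_insert _ _) (Set.mem_insert_of_mem _ h₂) (Set.mem_insert _ _)
  · exact conv_left (ax (z, A, y) (by simp) h₃)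

theorem id_symm (h₁ : (x, Pred.id, y) ∈ Γ) (h₂ : (y, Pred.id, x) ∈ Δ) : Derivable Ψ Γ Δ := by
  apply cut (x, Pred.id, x)
  · exact id_right x (by simp)
  · exact id_fst (Set.mem_insert _ _) (Set.mem_insert_of_mem _ h₁) h₂

/-- An identity on the left allows its first variable to be replaced by the second one in a formula
on the left. -/
theorem replace_left {u v : Fin n} (hid : (u, Pred.id, v) ∈ Γ)
    (h : Derivable Ψ (insert (if x = u then v else x, A, if y = u then v else y) Γ) Δ) :
    Derivable Ψ (insert (x, A, y) Γ) Δ := by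
  apply cut (if x = u then v else x, A, y)
  · split_ifs with hx
    · subst hx
      exact id_fst (Set.mem_insert _ _) (Set.mem_insert_of_mem _ hid) (Set.mem_insert _ _)
    · exact ax (x, A, y) (Set.mem_insert _ _) (Set.mem_insert _ _)
  apply cut (if x = u then v else x, A, if y = u then v else y)
  · by_cases hy : y = u
    · subst hy
      rw [if_pos rfl (c := y = y)]
      exact id_snd (Set.mem_insert _ _) (by simp [hid]) (Set.mem_insert _ _)
    · rw [if_neg hy]
      exact ax (_, A, y) (Set.mem_insert _ _) (Set.mem_insert _ _)
  · exact h.mono (Set.insert_subset_insert fun a ha => by simp [ha]) subset_rfl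

/-- An identity on the left allows its first variable to be replaced by the second one in a formula
on the right. -/
theorem replace_right {u v : Fin n} (hid : (u, Pred.id, v) ∈ Γ)
    (h : Derivable Ψ Γ (insert (if x = u then v else x, A, if y = u then v else y) Δ)) :
    Derivable Ψ Γ (insert (x, A, y) Δ) := by
  apply cut (if x = u then v else x, A, if y = u then v else y)
  · exact h.mono subset_rfl (Set.insert_subset_insert (Set.subset_insert _ _))
  apply cut (v, Pred.id, u)
  · exact id_symm (Set.mem_insert_of_mem _ hid) (Set.mem_insert _ _)
  apply cut (x, A, if y = u then v else y)
  · by_cases hx : x = u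
    · subst hx
      rw [if_pos rfl (c := x = x)]
      exact id_fst (Set.mem_insert_of_mem _ (Set.mem_insert _ _)) (Set.mem_insert _ _)
        (Set.mem_insert _ _)
    · rw [if_neg hx]
      exact ax (x, A, _) (by simp) (Set.mem_insert _ _)
  · by_cases hy : y = u
    · subst hy
      rw [if_pos rfl (c := y = y)]
      exact id_snd (Set.mem_insert _ _) (by simp) (Set.mem_insert _ _)
    · rw [if_neg hy]
      exact ax (x, A, y) (Set.mem_insert _ _) (Set.mem_insert _ _)

/-- A predicate that is derivable on the diagonal at one variable is so at every variable. -/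
theorem diagonal {P : Pred} (h : Derivable Ψ ∅ {(y, P, y)}) (x : Fin n) :
    Derivable Ψ ∅ {(x, P, x)} := by
  by_cases hxy : y = x
  · exact hxy ▸ h
  -- `Q` amounts to `id · compl P`. If `P` fails at `x`, then `x Q x`, hence `x (Q ; id) x`.
  -- Expanding this with `y` gives `x id y` while `x P y` fails, against `y P y`. No third variable
  -- is needed.
  set Q := Pred.compl (Pred.add (Pred.compl Pred.id) P) with hQ
  apply cut (x, Q, x)
  · rw [hQ]
    exact compl_right (add_left (compl_left (id_right x (by simp)))
      (ax (x, P, x) (by simp) (by simp)))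
  apply Derivable.mono (Γ := {(x, Q, x)}) (Δ := ∅) _ (by simp) (by simp)
  apply cut (x, Pred.rp Q Pred.id, x)
  · exact rp_right x (ax (x, Q, x) (by simp) (by simp)) (id_right x (by simp))
  apply Derivable.mono (Γ := {(x, Pred.rp Q Pred.id, x)}) (Δ := ∅) _ (by simp) (by simp)
  rw [← insert_empty_eq]
  apply rp_left y hxy hxy (by simp [NotIn]) (by simp [NotIn])
  rw [hQ]
  apply compl_left
  apply add_right
  apply compl_right
  apply cut (y, P, y)
  · exact h.mono (by simp) (by simp)
  apply cut (y, Pred.id, x)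
  · exact id_symm (Set.mem_insert_of_mem _ (Set.mem_insert _ _)) (Set.mem_insert _ _)
  · exact id_fst (y := y) (x := y) (by simp) (Set.mem_insert _ _) (Set.mem_insert _ _)

/-- From the inclusion of `A` in `B`, the implication between the converses. -/
theorem conv_impl (hxy : y ≠ x) (h : Derivable Ψ {(x, A, y)} {(x, B, y)}) :
    Derivable Ψ ∅ {(x, Pred.impl (Pred.conv A) (Pred.conv B), x)} := by
  rw [← insert_empty_eq]
  apply compl_right
  apply rp_left y hxy hxy (by simp [NotIn]) (by simp [NotIn])
  -- An implication asserted at `x` compares pairs `(y, x)`; the converses turn them into the pair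
  -- `(x, y)` of the hypothesis.
  apply conv_left
  apply conv_left
  rw [Set.insert_comm]
  apply compl_left
  apply conv_right
  exact h.mono (by simp) (by simp)

end Derivable

end Derivable

/-! ### A verified proof search -/

namespace Pred

/-- Simultaneous substitution of predicates for propositional variables. -/
def bind (σ : ℕ → Pred) : Pred → Pred
  | id => id
  | var k => σ k
  | add A B => add (A.bind σ) (B.bind σ)
  | compl A => compl (A.bind σ)
  | rp A B => rp (A.bind σ) (B.bind σ)
  | conv A => conv (A.bind σ)

/-- Equality test. -/
def beq : Pred → Pred → Bool
  | id, id => true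
  | var k, var l => k.beq l
  | add A B, add A' B' => A.beq A' && B.beq B'
  | compl A, compl A' => A.beq A'
  | rp A B, rp A' B' => A.beq A' && B.beq B'
  | conv A, conv A' => A.beq A'
  | _, _ => false

theorem eq_of_beq : ∀ {A B : Pred}, A.beq B = true → A = B
  | id, B, h | var _, B, h => by cases B <;> simp_all [beq]
  | add A A', B, h | rp A A', B, h => by
    cases B <;> simp only [beq, Bool.and_eq_true, reduceCtorEq] at h
    rw [eq_of_beq h.1, eq_of_beq h.2]
  | compl A, B, h | conv A, B, h => by
    cases B <;> simp only [beq, reduceCtorEq] at h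
    rw [eq_of_beq h]

end Pred

section Search

variable {n : ℕ}

/-- Equality test for formulas. -/
def atomBeq (a b : Atom n) : Bool :=
  a.1.val.beq b.1.val && a.2.2.val.beq b.2.2.val && a.2.1.beq b.2.1

/-- Membership test for lists of formulas. -/
def atomMem (a : Atom n) (l : List (Atom n)) : Bool := l.any (atomBeq a)

/-- The formula does not contain the variable `y`. -/
def atomAvoids (y : Fin n) (a : Atom n) : Bool := !a.1.val.beq y.val && !a.2.2.val.beq y.val

/-- Replacement of the variable `u` by `v` in a formula. -/
def atomReplace (u v : Fin n) (a : Atom n) : Atom n :=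
  (if a.1 = u then v else a.1, a.2.1, if a.2.2 = u then v else a.2.2)

/-- Substitution of predicates in a formula. -/
def atomBind (σ : ℕ → Pred) (a : Atom n) : Atom n := (a.1, a.2.1.bind σ, a.2.2)

/-- The formula `a` is a relative product, the variable `y` does not occur in it, and every formula
of `Γ` and `Δ` that contains `y` is on the diagonal. -/
def fresh (Γ Δ : List (Atom n)) (a : Atom n) (y : Fin n) : Bool :=
  (match a with
    | (_, .rp _ _, _) => true
    | _ => false) && atomAvoids y a &&
  (Γ ++ Δ).all fun a => atomAvoids y a || a.1.val.beq a.2.2.val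

/-- The relative product `a` on the left may be expanded with the variable `y`: if there is a fresh
choice, then only the first such choice is admitted. -/
def expandable (Γ Δ : List (Atom n)) (a : Atom n) (y : Fin n) : Bool :=
  match Γ.findSome? fun a => ((List.finRange n).find? (fresh Γ Δ a)).map (a, ·) with
  | some (a', y') => atomBeq a a' && y.val.beq y'.val
  | none => true

/-- Proof search. The sides of the sequent are split into unprocessed formulas `L` and `R` and
irreducible formulas `Γ` and `Δ`. The formulas in `H` may be assumed on the left at any time. The
number `b` bounds the expansions of relative products along a branch. Expanding a relative product
on the left drops all formulas that contain the new variable; of the two branches that a relative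
product on the right gives rise to, one has to be closed by at most one further expansion. -/
def search (H : List (Atom n)) : (fuel b : ℕ) → (L R Γ Δ : List (Atom n)) → Bool
  | 0, _, _, _, _, _ => false
  | f + 1, b, (x, .compl A, y) :: L, R, Γ, Δ => search H f b L ((x, A, y) :: R) Γ Δ
  | f + 1, b, (x, .conv A, y) :: L, R, Γ, Δ => search H f b ((y, A, x) :: L) R Γ Δ
  | f + 1, b, (x, .add A B, y) :: L, R, Γ, Δ =>
      search H f b ((x, A, y) :: L) R Γ Δ && search H f b ((x, B, y) :: L) R Γ Δ
  | f + 1, b, (x, .id, y) :: L, R, Γ, Δ =>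
      search H f b ((L ++ Γ).map (atomReplace x y)) ((R ++ Δ).map (atomReplace x y)) [] []
  | f + 1, b, (x, .var k, y) :: L, R, Γ, Δ =>
      atomMem (x, .var k, y) Δ || search H f b L R ((x, .var k, y) :: Γ) Δ
  | f + 1, b, (x, .rp A B, y) :: L, R, Γ, Δ =>
      atomMem (x, .rp A B, y) Δ || search H f b L R ((x, .rp A B, y) :: Γ) Δ
  | f + 1, b, [], (x, .compl A, y) :: R, Γ, Δ => search H f b [(x, A, y)] R Γ Δ
  | f + 1, b, [], (x, .conv A, y) :: R, Γ, Δ => search H f b [] ((y, A, x) :: R) Γ Δ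
  | f + 1, b, [], (x, .add A B, y) :: R, Γ, Δ =>
      search H f b [] ((x, A, y) :: (x, B, y) :: R) Γ Δ
  | f + 1, b, [], (x, .id, y) :: R, Γ, Δ =>
      x.val.beq y.val || search H f b [] R Γ ((x, .id, y) :: Δ)
  | f + 1, b, [], (x, .var k, y) :: R, Γ, Δ =>
      atomMem (x, .var k, y) Γ || search H f b [] R Γ ((x, .var k, y) :: Δ)
  | f + 1, b, [], (x, .rp A B, y) :: R, Γ, Δ =>
      atomMem (x, .rp A B, y) Γ || search H f b [] R Γ ((x, .rp A B, y) :: Δ)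
  | _ + 1, 0, [], [], _, _ => false
  | f + 1, b + 1, [], [], Γ, Δ =>
      ((Γ.any fun a => (List.finRange n).any fun y => atomAvoids y a &&
          expandable Γ Δ a y && match a with
          | (x, .rp A B, z) =>
              search H f b ((x, A, y) :: (y, B, z) :: H) []
                (Γ.filter fun a' => atomAvoids y a' && !atomBeq a a') (Δ.filter (atomAvoids y))
          | _ => false)) ||
      Δ.any (fun a => match a with
        | (x, .rp A B, z) =>
            let Δ' := Δ.filter (!atomBeq a ·)
            (List.finRange n).any fun y =>
              (search H f (min b 1) [] [(x, A, y)] Γ Δ' && search H f b [] [(y, B, z)] Γ Δ') ||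
              (search H f (min b 1) [] [(y, B, z)] Γ Δ' && search H f b [] [(x, A, y)] Γ Δ')
        | _ => false)

variable {Ψ : Set (Sequent n)} {σ : ℕ → Pred}

/-! ### Soundness of the search -/

theorem eq_of_atomBeq {a b : Atom n} (h : atomBeq a b = true) : a = b := by
  obtain ⟨x, A, y⟩ := a
  obtain ⟨u, B, v⟩ := b
  simp only [atomBeq, Bool.and_eq_true] at h
  rw [Pred.eq_of_beq h.2, Fin.ext (Nat.eq_of_beq_eq_true h.1.1),
    Fin.ext (Nat.eq_of_beq_eq_true h.1.2)]

theorem mem_of_atomMem {a : Atom n} {l : List (Atom n)} (h : atomMem a l = true) : a ∈ l := by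
  obtain ⟨b, hb, hab⟩ := List.any_eq_true.1 h
  rwa [eq_of_atomBeq hab]

theorem ne_of_not_beq {x y : Fin n} (h : (!x.val.beq y.val) = true) : y ≠ x := by
  rintro rfl
  simp at h

/-- The set of formulas that a list represents under a substitution. -/
def side (σ : ℕ → Pred) (l : List (Atom n)) : Set (Atom n) := {α | ∃ a ∈ l, atomBind σ a = α}

@[simp] theorem side_nil : side σ ([] : List (Atom n)) = ∅ := by simp [side]

@[simp] theorem side_cons (a : Atom n) (l : List (Atom n)) :
    side σ (a :: l) = insert (atomBind σ a) (side σ l) := by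
  ext; simp [side, eq_comm]

theorem side_mono {l l' : List (Atom n)} (h : l ⊆ l') : side σ l ⊆ side σ l' :=
  fun _ ⟨a, ha, h'⟩ => ⟨a, h ha, h'⟩

theorem mem_side {a : Atom n} {l : List (Atom n)} (h : a ∈ l) : atomBind σ a ∈ side σ l :=
  ⟨a, h, rfl⟩

/-- Derivability of the sequent that two lists represent under a substitution. -/
def ListDerivable (Ψ : Set (Sequent n)) (σ : ℕ → Pred) (L R : List (Atom n)) : Prop :=
  Derivable Ψ (side σ L) (side σ R)

namespace ListDerivable

variable {L R L' R' H : List (Atom n)}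

theorem mono (h : ListDerivable Ψ σ L R) (hL : L ⊆ L') (hR : R ⊆ R') : ListDerivable Ψ σ L' R' :=
  Derivable.mono h (side_mono hL) (side_mono hR)

theorem ax {a : Atom n} (h : a ∈ L) (h' : a ∈ R) : ListDerivable Ψ σ L R :=
  Derivable.ax (atomBind σ a) (mem_side h) (mem_side h')

/-- One cut for each formula of `H`. -/
theorem of_hyps (hH : ∀ a ∈ H, Derivable Ψ ∅ {atomBind σ a})
    (h : ListDerivable Ψ σ (H ++ L) R) : ListDerivable Ψ σ L R := by
  induction H with
  | nil => exact h
  | cons a H ih =>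
    refine ih (fun b hb => hH b (by simp [hb])) (Derivable.cut (atomBind σ a) ?_ ?_)
    · exact (hH a (by simp)).mono (Set.empty_subset _) (by simp)
    · simpa [ListDerivable] using h

/-- Formulas are rewritten one at a time. The list `L` stays untouched, so the identity remains
available throughout. -/
theorem replace {u v : Fin n} (hid : (u, Pred.id, v) ∈ side σ L) :
    ∀ {K R' : List (Atom n)},
      ListDerivable Ψ σ (K.map (atomReplace u v) ++ L) (R'.map (atomReplace u v) ++ R) →
      ListDerivable Ψ σ (K ++ L) (R' ++ R) := by
  have left : ∀ K M S, L ⊆ M → ListDerivable Ψ σ (K.map (atomReplace u v) ++ M) S →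
      ListDerivable Ψ σ (K ++ M) S := by
    intro K
    induction K with
    | nil => exact fun _ _ _ h => h
    | cons a K ih =>
      intro M S hM h
      have h' := ih (atomReplace u v a :: M) S (List.subset_cons_of_subset _ hM)
        (h.mono (by simp) (by simp))
      have := Derivable.replace_left
        (side_mono (List.Subset.trans hM (List.subset_append_right K M)) hid)
        (x := a.1) (A := a.2.1.bind σ) (y := a.2.2) (Δ := side σ S)
        (Derivable.mono h' (by
          change (_ : Set (Atom n)) ⊆ insert (atomBind σ (atomReplace u v a)) (side σ _)
          rw [← side_cons]
          exact side_mono (by simp)) subset_rfl)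
      simpa [ListDerivable, atomBind] using this
  have right : ∀ K M S, L ⊆ M → ListDerivable Ψ σ M (K.map (atomReplace u v) ++ S) →
      ListDerivable Ψ σ M (K ++ S) := by
    intro K
    induction K with
    | nil => exact fun _ _ _ h => h
    | cons a K ih =>
      intro M S hM h
      have h' := ih M (atomReplace u v a :: S) hM (h.mono (by simp) (by simp))
      have := Derivable.replace_right (side_mono hM hid)
        (x := a.1) (A := a.2.1.bind σ) (y := a.2.2) (Δ := side σ (K ++ S))
        (Derivable.mono h' subset_rfl (by
          change (_ : Set (Atom n)) ⊆ insert (atomBind σ (atomReplace u v a)) (side σ _)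
          rw [← side_cons]
          exact side_mono (by simp)))
      simpa [ListDerivable, atomBind] using this
  intro K R' h
  exact left K L _ (List.Subset.refl _) (right R' _ R (by simp) h)

end ListDerivable

theorem notIn_side_filter (y : Fin n) (l : List (Atom n)) :
    NotIn y (side σ (l.filter (atomAvoids y))) := by
  rintro _ ⟨a, ha, rfl⟩
  simp only [List.mem_filter, atomAvoids, Bool.and_eq_true] at ha
  exact ⟨(ne_of_not_beq ha.2.1).symm, (ne_of_not_beq ha.2.2).symm⟩

/-- Each clause of `search` is a rule of the calculus read backwards, up to dropping or moving
formulas, which `mono` absorbs. The heuristics only restrict which rules are tried, so they play no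
role here. -/
theorem search_sound {H : List (Atom n)} (hH : ∀ a ∈ H, Derivable Ψ ∅ {atomBind σ a}) :
    ∀ f b L R Γ Δ, search H f b L R Γ Δ = true → ListDerivable Ψ σ (L ++ Γ) (R ++ Δ) := by
  intro f
  induction f with
  | zero => intro b L R Γ Δ h; simp [search] at h
  | succ f ih =>
    intro b L R Γ Δ h
    rcases L with _ | ⟨⟨x, P, y⟩, L⟩
    · rcases R with _ | ⟨⟨x, P, y⟩, R⟩
      · rcases b with _ | b
        · simp [search] at h
        simp only [search, Bool.or_eq_true] at h
        rcases h with h | h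
        · obtain ⟨⟨x, P, z⟩, ha, hexp⟩ := List.any_eq_true.1 h
          obtain ⟨y, -, hsub⟩ := List.any_eq_true.1 hexp
          clear h hexp
          simp only [Bool.and_eq_true] at hsub
          cases P <;> simp only [and_false, Bool.false_eq_true] at hsub
          rename_i A B
          obtain ⟨⟨hy, -⟩, h⟩ := hsub
          simp only [atomAvoids, Bool.and_eq_true] at hy
          have h₁ := ih _ _ _ _ _ h
          -- `H` is cut away above the expansion, so its formulas may contain `y` without violating
          -- the condition on the new variable.
          have h₂ : ListDerivable Ψ σ ((x, A, y) :: (y, B, z) :: Γ.filter (atomAvoids y))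
              (Δ.filter (atomAvoids y)) := by
            refine ListDerivable.of_hyps hH (h₁.mono ?_ (by simp))
            intro a
            simp only [List.cons_append, List.mem_cons, List.mem_append, List.mem_filter,
              Bool.and_eq_true]
            tauto
          have h₃ := Derivable.rp_left (x := x) (z := z) (A := A.bind σ) (B := B.bind σ) y
            (ne_of_not_beq hy.1) (ne_of_not_beq hy.2) (notIn_side_filter (σ := σ) y Γ)
            (notIn_side_filter (σ := σ) y Δ) (by simpa [ListDerivable, atomBind] using h₂)
          exact h₃.mono (Set.insert_subset (mem_side ha) (side_mono (List.filter_subset_self _)))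
            (side_mono (List.filter_subset_self _))
        · obtain ⟨⟨x, P, z⟩, ha, hexp⟩ := List.any_eq_true.1 h
          clear h
          cases P <;> simp only [Bool.false_eq_true] at hexp
          rename_i A B
          obtain ⟨y, -, h⟩ := List.any_eq_true.1 hexp
          have h₁ : ListDerivable Ψ σ Γ ((x, A, y) :: Δ) ∧
              ListDerivable Ψ σ Γ ((y, B, z) :: Δ) := by
            simp only [Bool.or_eq_true, Bool.and_eq_true] at h
            rcases h with h | h
            · exact ⟨(ih _ _ _ _ _ h.1).mono (by simp) (by simp),
                (ih _ _ _ _ _ h.2).mono (by simp) (by simp)⟩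
            · exact ⟨(ih _ _ _ _ _ h.2).mono (by simp) (by simp),
                (ih _ _ _ _ _ h.1).mono (by simp) (by simp)⟩
          have := Derivable.rp_right (x := x) (z := z) (A := A.bind σ) (B := B.bind σ) y
            (by simpa [ListDerivable, atomBind] using h₁.1)
            (by simpa [ListDerivable, atomBind] using h₁.2)
          exact this.mono subset_rfl (Set.insert_subset (mem_side ha) subset_rfl)
      · cases P with
        | id =>
          simp only [search, Bool.or_eq_true] at h
          rcases h with h | h
          · rw [Fin.ext (Nat.eq_of_beq_eq_true h)]
            exact Derivable.id_right y (mem_side (a := (y, Pred.id, y)) (by simp))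
          · exact (ih _ _ _ _ _ h).mono (by simp) (by simp)
        | var k =>
          simp only [search, Bool.or_eq_true] at h
          rcases h with h | h
          · exact ListDerivable.ax (mem_of_atomMem h) (by simp)
          · exact (ih _ _ _ _ _ h).mono (by simp) (by simp)
        | add A B =>
          have := ih _ _ _ _ _ h
          have := Derivable.add_right (by simpa [ListDerivable, atomBind] using this)
          simpa [ListDerivable, atomBind, Pred.bind] using this
        | compl A =>
          have := ih _ _ _ _ _ h
          have := Derivable.compl_right (by simpa [ListDerivable, atomBind] using this)
          simpa [ListDerivable, atomBind, Pred.bind] using this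
        | rp A B =>
          simp only [search, Bool.or_eq_true] at h
          rcases h with h | h
          · exact ListDerivable.ax (mem_of_atomMem h) (by simp)
          · exact (ih _ _ _ _ _ h).mono (by simp) (by simp)
        | conv A =>
          have := ih _ _ _ _ _ h
          have := Derivable.conv_right (by simpa [ListDerivable, atomBind] using this)
          simpa [ListDerivable, atomBind, Pred.bind] using this
    · cases P with
        | id =>
          have := ih _ _ _ _ _ h
          refine Derivable.mono (ListDerivable.replace (σ := σ) (L := [(x, Pred.id, y)]) (R := [])
            (u := x) (v := y)
            (K := L ++ Γ) (R' := R ++ Δ) (by simp [atomBind, Pred.bind])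
            (this.mono (by simp) (by simp))) (side_mono (by simp)) (side_mono (by simp))
        | var k =>
          simp only [search, Bool.or_eq_true] at h
          rcases h with h | h
          · exact ListDerivable.ax (by simp) (List.mem_append_right _ (mem_of_atomMem h))
          · exact (ih _ _ _ _ _ h).mono (by simp) (by simp)
        | add A B =>
          simp only [search, Bool.and_eq_true] at h
          have h₁ := ih _ _ _ _ _ h.1
          have h₂ := ih _ _ _ _ _ h.2
          have := Derivable.add_left (by simpa [ListDerivable, atomBind] using h₁)
            (by simpa [ListDerivable, atomBind] using h₂)
          simpa [ListDerivable, atomBind, Pred.bind] using this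
        | compl A =>
          have := ih _ _ _ _ _ h
          have := Derivable.compl_left (by simpa [ListDerivable, atomBind] using this)
          simpa [ListDerivable, atomBind, Pred.bind] using this
        | rp A B =>
          simp only [search, Bool.or_eq_true] at h
          rcases h with h | h
          · exact ListDerivable.ax (by simp) (List.mem_append_right _ (mem_of_atomMem h))
          · exact (ih _ _ _ _ _ h).mono (by simp) (by simp)
        | conv A =>
          have := ih _ _ _ _ _ h
          have := Derivable.conv_left (by simpa [ListDerivable, atomBind] using this)
          simpa [ListDerivable, atomBind, Pred.bind] using this

end Search

/-- Proof search for a predicate from predicates asserted at given variables. -/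
def searchPred (n : ℕ) [NeZero n] (b : ℕ) (H : List (Fin n × Pred)) (Q : Pred) : Bool :=
  let H' := H.map fun p => (p.1, p.2, p.1)
  -- The fuel 200 only makes the recursion structural; `b` is the bound on expansions. `H'` is also
  -- placed on the left at the start.
  search H' 200 b H' [(0, Q, 0)] [] []


/-- Hypotheses are known at the variable 0 only; `diagonal` supplies them at the variables where the
search uses them. -/
theorem searchPred_sound {n : ℕ} [NeZero n] {Ψ : Set (Sequent n)} {b : ℕ}
    {H : List (Fin n × Pred)} {Q : Pred} (σ : ℕ → Pred)
    (hH : ∀ p ∈ H, Derivable Ψ ∅ {(0, p.2.bind σ, 0)}) (h : searchPred n b H Q = true) :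
    Derivable Ψ ∅ {(0, Q.bind σ, 0)} := by
  have hH' : ∀ a ∈ H.map fun p => (p.1, p.2, p.1), Derivable Ψ ∅ {atomBind σ a} := by
    intro a ha
    obtain ⟨p, hp, rfl⟩ := List.mem_map.1 ha
    exact (hH p hp).diagonal p.1
  have := ListDerivable.of_hyps hH' ((search_sound hH' _ _ _ _ _ _ h).mono (L' := _ ++ [])
    (R' := [(0, Q, 0)]) (by simp) (by simp))
  simpa [ListDerivable, atomBind] using this

/-! ### Provability of the predicates and rules in the sequent calculus -/

open RelLogic.Pred (var)

/-- The assignment of four predicates to the first four propositional variables. -/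
def assign (A B C D : Pred) : ℕ → Pred
  | 0 => A
  | 1 => B
  | 2 => C
  | _ => D

/-- The search is evaluated once on propositional variables; substituting `σ` then yields all
instances of the schemes. -/
theorem nProvable_of_search {n : ℕ} [NeZero n] {l : List Pred} (b : ℕ) (σ : ℕ → Pred)
    (h : ∀ P ∈ l, searchPred n b [] P = true) : ∀ P ∈ l.map (Pred.bind σ), NProvable n P := by
  intro P hP
  obtain ⟨Q, hQ, rfl⟩ := List.mem_map.1 hP
  exact (searchPred_sound σ (by simp) (h Q hQ)).provable

/-- The assumption of all the given predicates at all variables. -/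
def everywhere (n : ℕ) (l : List Pred) : List (Fin n × Pred) :=
  l.flatMap fun P => (List.finRange n).map (·, P)

theorem ruleNProvable_of_search {n : ℕ} [NeZero n] {l : List Rule} (b : ℕ) (σ : ℕ → Pred)
    (h : ∀ r ∈ l, searchPred n b (everywhere n r.premises) r.conclusion = true) :
    ∀ r ∈ l.map fun r => Rule.mk (r.premises.map (Pred.bind σ)) (r.conclusion.bind σ),
      RuleNProvable n r := by
  intro r hr
  obtain ⟨r', hr', rfl⟩ := List.mem_map.1 hr
  refine (searchPred_sound σ ?_ (h r' hr')).provable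
  intro p hp
  simp only [everywhere, List.mem_flatMap, List.mem_map] at hp
  obtain ⟨P, hP, x, -, rfl⟩ := hp
  have hs : assertion n (P.bind σ) ∈ {s | ∃ P ∈ r'.premises.map (Pred.bind σ), s = assertion n P} :=
    ⟨_, List.mem_map_of_mem hP, rfl⟩
  exact (SeqProvable.hyp _ hs).derivable_of_mem_right (Set.mem_singleton _)

theorem nProvable_preds1 (A : Pred) : ∀ P ∈ preds1 A, NProvable 1 P :=
  nProvable_of_search (l := preds1 (var 0)) 0 (assign A A A A) (by decide +kernel)

theorem nProvable_preds2 (A B C : Pred) : ∀ P ∈ preds2 A B C, NProvable 2 P :=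
  nProvable_of_search (l := preds2 (var 0) (var 1) (var 2)) 3 (assign A B C A) (by decide +kernel)

theorem nProvable_preds3 (A B C D : Pred) : ∀ P ∈ preds3 A B C D, NProvable 3 P :=
  nProvable_of_search (l := preds3 (var 0) (var 1) (var 2) (var 3)) 5 (assign A B C D)
    (by decide +kernel)

theorem nProvable_preds4 (A B C : Pred) : ∀ P ∈ preds4 A B C, NProvable 4 P :=
  nProvable_of_search (l := preds4 (var 0) (var 1) (var 2)) 5 (assign A B C A) (by decide +kernel)

theorem ruleNProvable_rules1 (A B : Pred) : ∀ r ∈ rules1 A B, RuleNProvable 1 r :=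
  ruleNProvable_of_search (l := rules1 (var 0) (var 1)) 1 (assign A B A A) (by decide +kernel)

theorem ruleNProvable_rules2 (A B C : Pred) : ∀ r ∈ rules2 A B C, RuleNProvable 2 r :=
  ruleNProvable_of_search (l := rules2 (var 0) (var 1) (var 2)) 3 (assign A B C A)
    (by decide +kernel)

theorem ruleNProvable_rules3 (A B C D : Pred) : ∀ r ∈ rules3 A B C D, RuleNProvable 3 r :=
  ruleNProvable_of_search (l := rules3 (var 0) (var 1) (var 2) (var 3)) 4 (assign A B C D)
    (by decide +kernel)

/-- The predicate that expresses the inclusion of `A` in `B` when it is asserted. -/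
def inclPred (A B : Pred) : Pred := A⁎ ⇾ B⁎

/-! ### Derivations from density, commutativity and symmetry -/

section Assumptions

variable {n : ℕ} [NeZero n] {Ψ : Set Equation}

/-- Derivability of `0 P 0` from the sequents that correspond to a set of equations. -/
def DerivableFrom (n : ℕ) [NeZero n] (Ψ : Set Equation) (P : Pred) : Prop :=
  Derivable (sequentsOf n Ψ) ∅ {(0, P, 0)}

theorem DerivableFrom.search (b : ℕ) (H : List (Fin n × Pred)) (Q : Pred) (σ : ℕ → Pred)
    (hH : ∀ p ∈ H, DerivableFrom n Ψ (p.2.bind σ)) (h : searchPred n b H Q = true) :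
    DerivableFrom n Ψ (Q.bind σ) :=
  searchPred_sound σ hH h

theorem inclPred_of_mem (hn : (1 : Fin n) ≠ 0) {A B : Pred} (h : Equation.mk A B ∈ Ψ) :
    DerivableFrom n Ψ (inclPred A B) :=
  have hs : Sequent.mk {(0, A, 1)} {(0, B, 1)} ∈ sequentsOf n Ψ := ⟨_, h, .inl rfl⟩
  .conv_impl hn ((SeqProvable.hyp _ hs).derivable_of_mem_left (Set.mem_singleton _))

/-- The inclusion `P ≤ P ; P` as a predicate. -/
def densPred (P : Pred) : Pred := inclPred (Pred.add P (Pred.rp P P)) (Pred.rp P P)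

/-- The inclusion `P ; Q ≤ Q ; P` as a predicate. -/
def commPred (P Q : Pred) : Pred := inclPred (Pred.rp P Q) (Pred.rp Q P)

theorem densPred_derivable (hn : (1 : Fin n) ≠ 0) (h : density ⊆ Ψ) (P : Pred) :
    DerivableFrom n Ψ (densPred P) :=
  inclPred_of_mem hn (h ⟨P, rfl⟩)

theorem commPred_derivable (hn : (1 : Fin n) ≠ 0) (h : commutativity ⊆ Ψ) (P Q : Pred) :
    DerivableFrom n Ψ (commPred P Q) :=
  inclPred_of_mem hn (h ⟨P, Q, rfl⟩)

theorem nProvableFrom_predsDensity3 (A B : Pred) :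
    ∀ P ∈ predsDensity3 A B, NProvableFrom 3 density P := by
  have hd := densPred_derivable (n := 3) (by decide) (subset_refl density)
  simp only [predsDensity3, List.forall_mem_cons, List.not_mem_nil, false_imp_iff, implies_true,
    and_true]
  refine ⟨?_, ?_, ?_⟩
  -- Here and below, an inclusion asserted at `i` applies to pairs with first member `i`. The search
  -- unfolds implications with the variables 1, 2, 3 in turn. Here `0 A 1` has to be split.
  · exact (DerivableFrom.search 4 [(0, densPred (var 0))]
      ((var 0 ⇾ ∼(var 0)) ⇾ ∼(var 0)) (assign A B A A)
      (List.forall_mem_singleton.2 (hd _)) (by decide +kernel)).provable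
  · exact (DerivableFrom.search 4 [(1, densPred (var 0 ⋏ var 1))]
      (var 0 ⋏ var 1 ⇾ var 0 ⊚ var 1) (assign A B A A)
      (List.forall_mem_singleton.2 (hd _)) (by decide +kernel)).provable
  -- If both disjuncts fail, then `0 A 1` and not `1 B 0`. Density of the conjunction gives `z` with
  -- `z A 1` and not `z B 0`, contrary to the implication.
  · exact (DerivableFrom.search 4 [(0, densPred (var 0 ⋏ (⌐(var 1))⁎))]
      ((var 0 ⇾ var 1) ⇾ ∼(var 0) ⋎ var 1) (assign A B A A)
      (List.forall_mem_singleton.2 (hd _)) (by decide +kernel)).provable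

theorem nProvableFrom_predsDensity4 (A B C : Pred) :
    ∀ P ∈ predsDensity4 A B C, NProvableFrom 4 density P := by
  have hd := densPred_derivable (n := 4) (by decide) (subset_refl density)
  simp only [predsDensity4, List.forall_mem_cons, List.not_mem_nil, false_imp_iff, implies_true,
    and_true]
  refine ⟨?_, ?_⟩
  · exact (DerivableFrom.search 6 [(2, densPred (var 0))]
      ((var 0 ⇾ (var 0 ⇾ var 1)) ⇾ (var 0 ⇾ var 1)) (assign A B C A)
      (List.forall_mem_singleton.2 (hd _)) (by decide +kernel)).provable
  · exact (DerivableFrom.search 6 [(2, densPred (var 0 ⋏ var 1))]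
      ((var 0 ⇾ (var 1 ⇾ var 2)) ⇾ (var 0 ⋏ var 1 ⇾ var 2)) (assign A B C A)
      (List.forall_mem_singleton.2 (hd _)) (by decide +kernel)).provable

theorem nProvableFrom_predsComm3 (A B : Pred) :
    ∀ P ∈ predsComm3 A B, NProvableFrom 3 commutativity P := by
  have hc := commPred_derivable (n := 3) (by decide) (subset_refl commutativity)
  simp only [predsComm3, List.forall_mem_cons, List.not_mem_nil, false_imp_iff, implies_true,
    and_true]
  refine ⟨?_, ?_⟩
  -- From `2 (A → B) 1` and `1 A 0`, exchanging the factors gives `2 (A ; (A → B)) 0`, to which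
  -- modus ponens applies.
  · exact (DerivableFrom.search 5 [(2, commPred (var 0 ⇾ var 1) (var 0))]
      (var 0 ⇾ ((var 0 ⇾ var 1) ⇾ var 1)) (assign A B A A)
      (List.forall_mem_singleton.2 (hc _ _)) (by decide +kernel)).provable
  · exact (DerivableFrom.search 5 [(0, commPred (var 0) (var 1))]
      ((var 0 ⇾ ∼(var 1)) ⇾ (var 1 ⇾ ∼(var 0))) (assign A B A A)
      (List.forall_mem_singleton.2 (hc _ _)) (by decide +kernel)).provable

theorem nProvableFrom_predsComm4 (A B C : Pred) :
    ∀ P ∈ predsComm4 A B C, NProvableFrom 4 commutativity P := by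
  have hc := commPred_derivable (n := 4) (by decide) (subset_refl commutativity)
  simp only [predsComm4, List.forall_mem_cons, List.not_mem_nil, false_imp_iff, implies_true,
    and_true]
  refine ⟨?_, ?_⟩
  · exact (DerivableFrom.search 7 [(3, commPred (var 0) (var 1))]
      ((var 0 ⇾ (var 1 ⇾ var 2)) ⇾ (var 1 ⇾ (var 0 ⇾ var 2))) (assign A B C A)
      (List.forall_mem_singleton.2 (hc _ _)) (by decide +kernel)).provable
  -- Modus ponens with its factors exchanged. In the main derivation, `3 A 2` and `2 (B → C) 1` give
  -- `3 ((B → C) ; A) 1` by commutativity. The midpoint reuses the variable 2, `A → B` turns `A`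
  -- into `B`, and this inclusion finishes.
  · have hmp : DerivableFrom 4 commutativity (inclPred (Pred.rp (B ⇾ C) B) C) :=
      .search 4 [(0, commPred (var 1 ⇾ var 2) (var 1))]
        (inclPred (Pred.rp (var 1 ⇾ var 2) (var 1)) (var 2)) (assign A B C A)
        (List.forall_mem_singleton.2 (hc _ _)) (by decide +kernel)
    exact (DerivableFrom.search 8 [(3, commPred (var 0) (var 1 ⇾ var 2)),
        (3, inclPred (Pred.rp (var 1 ⇾ var 2) (var 1)) (var 2))]
      ((var 0 ⇾ var 1) ⇾ ((var 1 ⇾ var 2) ⇾ (var 0 ⇾ var 2))) (assign A B C A)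
      (List.forall_mem_cons.2 ⟨hc _ _, List.forall_mem_singleton.2 hmp⟩)
      (by decide +kernel)).provable

theorem nProvableFrom_selfDist (A B C : Pred) :
    NProvableFrom 4 (density ∪ commutativity) (selfDist A B C) := by
  have hd := densPred_derivable (n := 4) (by decide) (Set.subset_union_left (s := density)
    (t := commutativity))
  have hc := commPred_derivable (n := 4) (by decide) (Set.subset_union_right (s := density)
    (t := commutativity))
  -- Split `x A z` by density into `x A u` and `u A z`; then `z (A → B) y` yields `u B y`. As a
  -- separate derivation this has all four variables for `x, y, z, u`.
  have hmp : DerivableFrom 4 (density ∪ commutativity)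
      (inclPred (Pred.rp A (A ⇾ B)) (Pred.rp A B)) :=
    .search 6 [(0, densPred (var 0))]
      (inclPred (Pred.rp (var 0) (var 0 ⇾ var 1)) (Pred.rp (var 0) (var 1))) (assign A B C A)
      (List.forall_mem_singleton.2 (hd _)) (by decide +kernel)
  have hmp' : DerivableFrom 4 (density ∪ commutativity)
      (inclPred (Pred.rp A (A ⇾ B)) (Pred.rp B A)) :=
    .search 4 [(0, commPred (var 0) (var 1)),
        (0, inclPred (Pred.rp (var 0) (var 0 ⇾ var 1)) (Pred.rp (var 0) (var 1)))]
      (inclPred (Pred.rp (var 0) (var 0 ⇾ var 1)) (Pred.rp (var 1) (var 0))) (assign A B C A)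
      (List.forall_mem_cons.2 ⟨hc _ _, List.forall_mem_singleton.2 hmp⟩) (by decide +kernel)
  -- The inclusion turns `3 A 2` and `2 (A → B) 1` into `3 (B ; A) 1`. The midpoint can reuse 2, and
  -- the premise at `(1, 0)` is applied to `A`, then to `B`.
  exact (DerivableFrom.search 7
    [(3, inclPred (Pred.rp (var 0) (var 0 ⇾ var 1)) (Pred.rp (var 1) (var 0)))]
    (selfDist (var 0) (var 1) (var 2)) (assign A B C A)
    (List.forall_mem_singleton.2 hmp') (by decide +kernel)).provable

theorem symmPred_derivable (hn : (1 : Fin n) ≠ 0) (P : Pred) :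
    DerivableFrom n symmetry (inclPred P P⁎) :=
  inclPred_of_mem hn ⟨P, rfl⟩

theorem nProvableFrom_symmetry2 (A B : Pred) : NProvableFrom 2 symmetry (A ⋏ ∼A ⇾ B) :=
  (DerivableFrom.search 2 [(1, inclPred (var 0) (var 0)⁎)]
    (var 0 ⋏ ∼(var 0) ⇾ var 1) (assign A B A A)
    (List.forall_mem_singleton.2 (symmPred_derivable (by decide) A)) (by decide +kernel)).provable

theorem nProvableFrom_symmetry3 (A B : Pred) : NProvableFrom 3 symmetry (A ⊚ B ⇾ B ⊚ A) :=
  have hs := symmPred_derivable (n := 3) (by decide)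
  -- Reverse the product from `(1, 0)` to `(0, 1)`, split it at 2, then reverse each factor; the
  -- factors now compose from 1 to 0 in the other order.
  (DerivableFrom.search 5 [(1, inclPred (var 0 ⊚ var 1) (var 0 ⊚ var 1)⁎),
      (2, inclPred (var 0) (var 0)⁎), (0, inclPred (var 1) (var 1)⁎)]
    (var 0 ⊚ var 1 ⇾ var 1 ⊚ var 0) (assign A B A A)
    (List.forall_mem_cons.2 ⟨hs (A ⊚ B), List.forall_mem_cons.2 ⟨hs A,
      List.forall_mem_singleton.2 (hs B)⟩⟩) (by decide +kernel)).provable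

end Assumptions

/-! ### Sentences and their closures -/

namespace Formula

theorem lt_of_mem_freeVars {n : ℕ} : ∀ {φ : Formula}, φ.VarsBelow n → ∀ {x}, x ∈ φ.freeVars → x < n
  | rel u A v, h, x, hx => by
    simp only [freeVars, Finset.mem_insert, Finset.mem_singleton] at hx
    rcases hx with rfl | rfl
    exacts [h.1, h.2]
  | eqn e, _, x, hx => by simp [freeVars] at hx
  | imp φ ψ, h, x, hx => (Finset.mem_union.1 hx).elim (lt_of_mem_freeVars h.1)
      (lt_of_mem_freeVars h.2)
  | neg φ, h, x, hx => lt_of_mem_freeVars (φ := φ) h hx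
  | all y φ, h, x, hx => lt_of_mem_freeVars h.2 (Finset.mem_of_mem_erase hx)

theorem varsBelow_foldr_all {n : ℕ} {φ : Formula} {l : List ℕ} (hl : ∀ x ∈ l, x < n)
    (h : φ.VarsBelow n) : (l.foldr all φ).VarsBelow n := by
  induction l with
  | nil => exact h
  | cons x l ih => exact ⟨hl x (by simp), ih fun y hy => hl y (by simp [hy])⟩

theorem VarsBelow.closure {n : ℕ} {φ : Formula} (h : φ.VarsBelow n) : φ.closure.VarsBelow n :=
  varsBelow_foldr_all (fun _ hx => lt_of_mem_freeVars h ((Finset.mem_sort _).1 hx)) h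

theorem freeVars_foldr_all (l : List ℕ) (φ : Formula) :
    (l.foldr all φ).freeVars = φ.freeVars \ l.toFinset := by
  induction l with
  | nil => simp
  | cons x l ih =>
    ext y
    simp only [List.foldr_cons, freeVars, ih, Finset.mem_erase, Finset.mem_sdiff,
      List.toFinset_cons, Finset.mem_insert]
    tauto

theorem freeVars_closure (φ : Formula) : φ.closure.freeVars = ∅ := by
  simp [closure, freeVars_foldr_all]

theorem closure_of_closed {φ : Formula} (h : φ.freeVars = ∅) : φ.closure = φ := by
  simp [closure, h]

/-- The closure already has the largest free variable as its innermost quantifier. -/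
theorem closure_all_of_max {φ : Formula} {x : ℕ} (hx : x ∈ φ.freeVars)
    (hmax : ∀ y ∈ φ.freeVars, y ≤ x) : (all x φ).closure = φ.closure := by
  have hsort : φ.freeVars.sort (· ≤ ·) = (φ.freeVars.erase x).sort (· ≤ ·) ++ [x] := by
    refine List.Perm.eq_of_pairwise (le := (· ≤ ·)) (fun a b _ _ => le_antisymm)
      (Finset.pairwise_sort _ _) ?_ ?_
    · rw [List.pairwise_append]
      refine ⟨Finset.pairwise_sort _ _, by simp, fun a ha b hb => ?_⟩
      rw [List.mem_singleton.1 hb]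
      exact hmax a (Finset.mem_of_mem_erase ((Finset.mem_sort _).1 ha))
    · refine (List.perm_ext_iff_of_nodup (Finset.sort_nodup _ _) ?_).2 fun a => ?_
      · rw [List.nodup_append]
        exact ⟨Finset.sort_nodup _ _, by simp, by simp +contextual⟩
      · by_cases h : a = x <;> simp [h, hx]
  rw [closure, closure, hsort, List.foldr_append]
  rfl

end Formula

section Closures

open Formula

variable {n : ℕ} {Ψ : Set Equation} {φ ψ : Formula} {x y : ℕ}

theorem FOProvable.basic_closure (h : IsBasic φ.closure) (hn : φ.VarsBelow n) :
    FOProvable n Ψ φ.closure :=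
  .basic _ h hn.closure

/-- Peel off the innermost common quantifier and distribute it over the implication. That
distribution is itself an instance of the claim with one free variable fewer. -/
theorem FOProvable.closure_mp_of_freeVars_eq (k : ℕ) : ∀ {φ ψ : Formula}, φ.freeVars.card = k →
    φ.freeVars = ψ.freeVars → φ.VarsBelow n → ψ.VarsBelow n →
    FOProvable n Ψ (imp φ ψ).closure → FOProvable n Ψ φ.closure → FOProvable n Ψ ψ.closure := by
  induction k with
  | zero =>
    intro φ ψ hk hfv _ _ h h'
    have hφ := Finset.card_eq_zero.1 hk
    have hψ := hfv ▸ hφ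
    rw [closure_of_closed (by simp [freeVars, hφ, hψ])] at h
    rw [closure_of_closed hφ] at h'
    rw [closure_of_closed hψ]
    exact .mp _ _ h h'
  | succ k ih =>
    intro φ ψ hk hfv hφ hψ h h'
    have hne : φ.freeVars.Nonempty := Finset.card_pos.1 (by omega)
    obtain ⟨x, hx, hmax⟩ : ∃ x ∈ φ.freeVars, ∀ y ∈ φ.freeVars, y ≤ x :=
      ⟨_, Finset.max'_mem _ hne, fun y hy => Finset.le_max' _ y hy⟩
    have hxn := lt_of_mem_freeVars hφ hx
    rw [← closure_all_of_max (x := x) (by simp [freeVars, hx])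
      (by simpa [freeVars, ← hfv] using hmax)] at h
    rw [← closure_all_of_max hx hmax] at h'
    rw [← closure_all_of_max (φ := ψ) (x := x) (hfv ▸ hx) (hfv ▸ hmax)]
    refine ih (φ := all x φ) ?_ (by simp [freeVars, hfv]) ⟨hxn, hφ⟩ ⟨hxn, hψ⟩ ?_ h'
    · simp only [freeVars, Finset.card_erase_of_mem hx]
      omega
    refine ih (φ := all x (imp φ ψ)) (ψ := imp (all x φ) (all x ψ)) ?_
      (by simp [freeVars, hfv]) ⟨hxn, hφ, hψ⟩
      ⟨⟨hxn, hφ⟩, hxn, hψ⟩ (.basic_closure (.all_imp x φ ψ) ⟨⟨hxn, hφ, hψ⟩, ⟨hxn, hφ⟩, hxn, hψ⟩) h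
    simp only [freeVars, ← hfv, Finset.union_self, Finset.card_erase_of_mem hx]
    omega

theorem FOProvable.closure_all_all (hx : x < n) (hy : y < n) (hφ : φ.VarsBelow n)
    (h : FOProvable n Ψ (all x (all y φ)).closure) : FOProvable n Ψ (all y (all x φ)).closure :=
  closure_mp_of_freeVars_eq (φ := all x (all y φ)) (ψ := all y (all x φ)) _ rfl
    (by simp [freeVars, Finset.erase_right_comm])
    ⟨hx, hy, hφ⟩ ⟨hy, hx, hφ⟩
    (.basic_closure (.all_comm x y φ) ⟨⟨hx, hy, hφ⟩, hy, hx, hφ⟩) h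

/-- If `x` is free, it is commuted past the larger free variables to its place in the closure;
otherwise the quantifier is vacuous. -/
theorem FOProvable.closure_all_iff (hx : x < n) (hφ : φ.VarsBelow n) :
    FOProvable n Ψ (all x φ).closure ↔ FOProvable n Ψ φ.closure := by
  by_cases hxφ : x ∈ φ.freeVars
  · induction h : φ.freeVars.card generalizing φ with
    | zero => simp [Finset.card_eq_zero.1 h] at hxφ
    | succ k ih =>
      obtain ⟨y, hy, hmax⟩ : ∃ y ∈ φ.freeVars, ∀ z ∈ φ.freeVars, z ≤ y :=
        ⟨_, Finset.max'_mem _ ⟨x, hxφ⟩, fun z hz => Finset.le_max' _ z hz⟩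
      by_cases hxy : x = y
      · rw [hxy, closure_all_of_max hy hmax]
      have hyn := lt_of_mem_freeVars hφ hy
      rw [← closure_all_of_max hy hmax, ← ih (φ := all y φ) ⟨hyn, hφ⟩
          (by simp [freeVars, hxφ, hxy])
          (by simp only [freeVars, Finset.card_erase_of_mem hy]; omega),
        ← closure_all_of_max (φ := all x φ) (x := y) (by simp [freeVars, hy, Ne.symm hxy])
          fun z hz => hmax z (Finset.mem_of_mem_erase hz)]
      exact ⟨closure_all_all hyn hx hφ, closure_all_all hx hyn hφ⟩
  · have hfv : (all x φ).freeVars = φ.freeVars := by simp [freeVars, hxφ]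
    exact ⟨closure_mp_of_freeVars_eq _ rfl hfv ⟨hx, hφ⟩ hφ
        (.basic_closure (.all_elim x φ) ⟨⟨hx, hφ⟩, hφ⟩),
      closure_mp_of_freeVars_eq _ rfl hfv.symm hφ ⟨hx, hφ⟩
        (.basic_closure (.all_vacuous x φ hxφ) ⟨hφ, hx, hφ⟩)⟩

/-- Quantifying both sides over a variable of the implication lowers the number of free variables,
even if only one side contains it. -/
theorem FOProvable.closure_mp (hφ : φ.VarsBelow n) (hψ : ψ.VarsBelow n)
    (h : FOProvable n Ψ (imp φ ψ).closure) (h' : FOProvable n Ψ φ.closure) :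
    FOProvable n Ψ ψ.closure := by
  induction hk : (imp φ ψ).freeVars.card generalizing φ ψ with
  | zero =>
    have hfv := Finset.card_eq_zero.1 hk
    simp only [freeVars, Finset.union_eq_empty] at hfv
    exact closure_mp_of_freeVars_eq _ rfl (hfv.1.trans hfv.2.symm) hφ hψ h h'
  | succ k ih =>
    obtain ⟨x, hx⟩ : (imp φ ψ).freeVars.Nonempty := Finset.card_pos.1 (by omega)
    have hxn := lt_of_mem_freeVars (φ := imp φ ψ) ⟨hφ, hψ⟩ hx
    have hfv : (imp (all x φ) (all x ψ)).freeVars = (imp φ ψ).freeVars.erase x := by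
      simp [freeVars, Finset.erase_union_distrib]
    have hcard : ((imp φ ψ).freeVars.erase x).card = k := by
      rw [Finset.card_erase_of_mem hx, hk, Nat.add_sub_cancel]
    have h₁ : FOProvable n Ψ (imp (all x φ) (all x ψ)).closure := by
      refine ih (φ := all x (imp φ ψ)) (ψ := imp (all x φ) (all x ψ)) ⟨hxn, hφ, hψ⟩
        ⟨⟨hxn, hφ⟩, hxn, hψ⟩
        (.basic_closure (.all_imp x φ ψ) ⟨⟨hxn, hφ, hψ⟩, ⟨hxn, hφ⟩, hxn, hψ⟩)
        ((closure_all_iff (φ := imp φ ψ) hxn ⟨hφ, hψ⟩).2 h) ?_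
      rw [← hcard, ← Finset.union_self ((imp φ ψ).freeVars.erase x), ← hfv, freeVars, hfv]
      rfl
    exact (closure_all_iff hxn hψ).1 (ih (φ := all x φ) (ψ := all x ψ) ⟨hxn, hφ⟩ ⟨hxn, hψ⟩ h₁
      ((closure_all_iff hxn hφ).2 h') (hfv ▸ hcard))

end Closures

/-! ### Reasoning with open formulas -/

/-- Formulas in which only the first `n` variables occur. -/
abbrev BForm (n : ℕ) : Type := {φ : Formula // φ.VarsBelow n}

namespace BForm

variable {n : ℕ}

def rel (x : Fin n) (A : Pred) (y : Fin n) : BForm n := ⟨.rel x A y, x.2, y.2⟩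
def eqn (e : Equation) : BForm n := ⟨.eqn e, trivial⟩
def imp (φ ψ : BForm n) : BForm n := ⟨.imp φ.1 ψ.1, φ.2, ψ.2⟩
def neg (φ : BForm n) : BForm n := ⟨.neg φ.1, φ.2⟩
def all (x : Fin n) (φ : BForm n) : BForm n := ⟨.all x φ.1, x.2, φ.2⟩
def or (φ ψ : BForm n) : BForm n := imp (neg φ) ψ
def and (φ ψ : BForm n) : BForm n := neg (imp φ (neg ψ))
def iff (φ ψ : BForm n) : BForm n := neg (imp (imp φ ψ) (neg (imp ψ φ)))
def ex (x : Fin n) (φ : BForm n) : BForm n := neg (all x (neg φ))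

/-- The variable `x` is not free in `φ`. -/
def NotFree (x : Fin n) (φ : BForm n) : Prop := (x : ℕ) ∉ φ.1.freeVars

end BForm

open BForm

/-- Provability of the closure of a formula. -/
def Thm (n : ℕ) (Ψ : Set Equation) (φ : BForm n) : Prop := FOProvable n Ψ φ.1.closure

namespace Thm

variable {n : ℕ} {Ψ : Set Equation} {φ ψ χ θ : BForm n}

theorem mp (h : Thm n Ψ (imp φ ψ)) (h' : Thm n Ψ φ) : Thm n Ψ ψ := .closure_mp φ.2 ψ.2 h h'

theorem gen (x : Fin n) (h : Thm n Ψ φ) : Thm n Ψ (all x φ) :=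
  (FOProvable.closure_all_iff x.2 φ.2).2 h

theorem of_isBasic (h : IsBasic φ.1.closure) : Thm n Ψ φ := .basic_closure h φ.2

theorem syll (φ ψ χ : BForm n) : Thm n Ψ (imp (imp φ ψ) (imp (imp ψ χ) (imp φ χ))) :=
  of_isBasic (.syll φ.1 ψ.1 χ.1)

theorem clavius (φ : BForm n) : Thm n Ψ (imp (imp (neg φ) φ) φ) := of_isBasic (.clavius φ.1)

theorem scotus (φ ψ : BForm n) : Thm n Ψ (imp φ (imp (neg φ) ψ)) := of_isBasic (.scotus φ.1 ψ.1)

theorem all_imp (x : Fin n) (φ ψ : BForm n) :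
    Thm n Ψ (imp (all x (imp φ ψ)) (imp (all x φ) (all x ψ))) := of_isBasic (.all_imp x φ.1 ψ.1)

theorem all_elim (x : Fin n) (φ : BForm n) : Thm n Ψ (imp (all x φ) φ) :=
  of_isBasic (.all_elim x φ.1)

theorem all_vacuous (x : Fin n) (φ : BForm n) (h : NotFree x φ) : Thm n Ψ (imp φ (all x φ)) :=
  of_isBasic (.all_vacuous x φ.1 h)

theorem ex_eq {x y : Fin n} (h : x ≠ y) : Thm n Ψ (ex x (rel x Pred.id y)) :=
  of_isBasic (.ex_eq x y (Fin.val_ne_of_ne h))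

theorem trans (h₁ : Thm n Ψ (imp φ ψ)) (h₂ : Thm n Ψ (imp ψ χ)) : Thm n Ψ (imp φ χ) :=
  ((syll φ ψ χ).mp h₁).mp h₂

/-- This and the next lemmas derive weakening, contraction and exchange from Łukasiewicz's three
axioms, the input for the deduction theorem. -/
theorem syll_neg (φ ψ χ θ : BForm n) :
    Thm n Ψ (imp (imp φ (neg ψ)) (imp (imp (imp φ χ) θ) (imp ψ θ))) :=
  ((syll φ (neg ψ) χ).trans ((syll _ _ _).mp (scotus ψ χ))).trans (syll _ _ _)

theorem imp_syll_neg (φ ψ χ θ : BForm n) :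
    Thm n Ψ (imp φ (imp (imp (imp (neg φ) ψ) χ) (imp θ χ))) :=
  (scotus φ (neg θ)).trans (syll_neg _ _ _ _)

theorem clavius_mp (φ ψ : BForm n) : Thm n Ψ (imp (imp (imp (imp (neg φ) φ) φ) ψ) ψ) :=
  ((syll _ _ ψ).mp (((imp_syll_neg _ _ _ (neg ψ)).mp (clavius φ)).mp (clavius _))).trans (clavius ψ)

theorem weaken (φ ψ : BForm n) : Thm n Ψ (imp φ (imp ψ φ)) :=
  (imp_syll_neg φ φ φ ψ).trans (clavius_mp _ _)

theorem contract (φ ψ : BForm n) : Thm n Ψ (imp (imp φ (imp φ ψ)) (imp φ ψ)) := by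
  have h : Thm n Ψ (imp (neg (imp φ ψ)) (imp (imp φ ψ) ψ)) :=
    ((weaken _ (neg ψ)).trans (syll_neg _ _ ψ ψ)).trans (clavius_mp _ _)
  exact (syll _ _ ψ).trans (((syll _ _ _).mp h).trans (clavius _))

theorem exchange (φ ψ χ : BForm n) : Thm n Ψ (imp (imp φ (imp ψ χ)) (imp ψ (imp φ χ))) := by
  have h : Thm n Ψ (imp ψ (imp (imp ψ χ) χ)) :=
    ((weaken ψ (imp ψ χ)).trans (syll _ _ χ)).trans (contract _ _)
  exact (syll _ _ χ).trans ((syll _ _ _).mp h)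

theorem prefixing (φ ψ χ : BForm n) : Thm n Ψ (imp (imp φ ψ) (imp (imp χ φ) (imp χ ψ))) :=
  (exchange _ _ _).mp (syll χ φ ψ)

theorem distrib (φ ψ χ : BForm n) :
    Thm n Ψ (imp (imp φ (imp ψ χ)) (imp (imp φ ψ) (imp φ χ))) :=
  ((exchange φ ψ χ).trans (prefixing _ _ _)).trans ((prefixing _ _ _).mp (contract φ χ))

theorem refl (φ : BForm n) : Thm n Ψ (imp φ φ) := (contract φ φ).mp (weaken φ φ)

end Thm

/-- Derivability of a formula from a set of formulas, without generalization on their variables. -/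
inductive Entails {n : ℕ} (Ψ : Set Equation) (S : Set (BForm n)) : BForm n → Prop
  | mem {φ : BForm n} (h : φ ∈ S) : Entails Ψ S φ
  | thm {φ : BForm n} (h : Thm n Ψ φ) : Entails Ψ S φ
  | mp {φ ψ : BForm n} (h₁ : Entails Ψ S (imp φ ψ)) (h₂ : Entails Ψ S φ) : Entails Ψ S ψ

/-- Every formula is derivable. -/
def Inconsistent {n : ℕ} (Ψ : Set Equation) (S : Set (BForm n)) : Prop := ∀ φ, Entails Ψ S φ

namespace Entails

variable {n : ℕ} {Ψ : Set Equation} {S T : Set (BForm n)} {φ ψ χ : BForm n}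

theorem mono (h : Entails Ψ S φ) (hST : S ⊆ T) : Entails Ψ T φ := by
  induction h with
  | mem h => exact mem (hST h)
  | thm h => exact thm h
  | mp _ _ ih₁ ih₂ => exact mp ih₁ ih₂

theorem mem_insert : Entails Ψ (insert φ S) φ := mem (Set.mem_insert _ _)

theorem insert (h : Entails Ψ S φ) : Entails Ψ (insert ψ S) φ := h.mono (Set.subset_insert _ _)

theorem toThm (h : Entails Ψ ∅ φ) : Thm n Ψ φ := by
  induction h with
  | mem h => exact h.elim
  | thm h => exact h
  | mp _ _ ih₁ ih₂ => exact ih₁.mp ih₂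

/-- The deduction theorem holds without a proviso on variables, because generalization enters
`Entails` only through theorems. -/
theorem imp_intro (h : Entails Ψ (Insert.insert φ S) ψ) : Entails Ψ S (imp φ ψ) := by
  induction h with
  | mem h =>
    rcases h with rfl | h
    · exact thm (.refl _)
    · exact mp (thm (.weaken _ _)) (mem h)
  | thm h => exact thm ((Thm.weaken _ _).mp h)
  | mp _ _ ih₁ ih₂ => exact mp (mp (thm (.distrib _ _ _)) ih₁) ih₂

theorem gen (x : Fin n) (hx : ∀ ψ ∈ S, NotFree x ψ) (h : Entails Ψ S φ) :
    Entails Ψ S (all x φ) := by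
  induction h with
  | mem h => exact mp (thm (.all_vacuous x _ (hx _ h))) (mem h)
  | thm h => exact thm (h.gen x)
  | mp _ _ ih₁ ih₂ => exact mp (mp (thm (.all_imp x _ _)) ih₁) ih₂

theorem absurd (h : Entails Ψ S φ) (h' : Entails Ψ S (neg φ)) : Inconsistent Ψ S :=
  fun _ => mp (mp (thm (.scotus _ _)) h) h'

theorem reductio (h : Inconsistent Ψ (Insert.insert (neg φ) S)) : Entails Ψ S φ :=
  mp (thm (.clavius φ)) (imp_intro (h φ))

theorem neg_intro (h : Inconsistent Ψ (Insert.insert φ S)) : Entails Ψ S (neg φ) := by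
  refine reductio ?_
  have hφ : Entails Ψ (Insert.insert (neg (neg φ)) S) φ :=
    reductio (mem_insert.absurd (mem_insert.insert))
  exact (mp (imp_intro (h (neg φ))).insert hφ).absurd mem_insert

theorem neg_iff : Entails Ψ S (neg φ) ↔ Inconsistent Ψ (Insert.insert φ S) :=
  ⟨fun h => mem_insert.absurd h.insert, neg_intro⟩

theorem iff_inconsistent : Entails Ψ S φ ↔ Inconsistent Ψ (Insert.insert (neg φ) S) :=
  ⟨fun h => h.insert.absurd mem_insert, reductio⟩

theorem and_iff : Entails Ψ S (and φ ψ) ↔ Entails Ψ S φ ∧ Entails Ψ S ψ := by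
  refine ⟨fun h => ⟨reductio ?_, reductio ?_⟩, fun ⟨h₁, h₂⟩ => neg_intro ?_⟩
  · exact (imp_intro (φ := φ) (mem_insert.absurd mem_insert.insert (neg ψ))).absurd h.insert
  · exact (imp_intro mem_insert.insert).absurd h.insert
  · exact h₂.insert.absurd (mp mem_insert h₁.insert)

theorem iff_congr (h : Entails Ψ S (iff φ ψ)) : Entails Ψ S φ ↔ Entails Ψ S ψ := by
  obtain ⟨h₁, h₂⟩ := (and_iff (φ := imp φ ψ) (ψ := imp ψ φ)).1 h
  exact ⟨mp h₁, mp h₂⟩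

end Entails

theorem Inconsistent.mono {n : ℕ} {Ψ : Set Equation} {S T : Set (BForm n)} (h : Inconsistent Ψ S)
    (hST : S ⊆ T) : Inconsistent Ψ T :=
  fun φ => (h φ).mono hST

/-- A formula that is both derivable and refutable. -/
theorem Inconsistent.of_entails {n : ℕ} {Ψ : Set Equation} {S : Set (BForm n)} {φ : BForm n}
    (h : Entails Ψ S φ) (h' : Inconsistent Ψ (insert φ S)) : Inconsistent Ψ S :=
  h.absurd (.neg_intro h')

/-! ### Substitution and the operators on predicates -/

namespace Formula

theorem VarsBelow.switch {n x y : ℕ} (hx : x < n) (hy : y < n) :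
    ∀ {φ : Formula}, φ.VarsBelow n → (φ.switch x y).VarsBelow n := by
  have hswap : ∀ z < n, Equiv.swap x y z < n := by
    intro z hz
    rw [Equiv.swap_apply_def]
    split_ifs <;> assumption
  intro φ
  induction φ with
  | rel u A v => exact fun h => ⟨hswap _ h.1, hswap _ h.2⟩
  | eqn e => exact fun _ => trivial
  | imp φ ψ ih₁ ih₂ => exact fun h => ⟨ih₁ h.1, ih₂ h.2⟩
  | neg φ ih => exact fun h => ih h
  | all z φ ih => exact fun h => ⟨hswap _ h.1, ih h.2⟩

theorem VarsBelow.subst {n x y : ℕ} (hx : x < n) (hy : y < n) :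
    ∀ {φ : Formula}, φ.VarsBelow n → (φ.subst x y).VarsBelow n := by
  intro φ
  induction φ with
  | rel u A v =>
    intro h
    simp only [Formula.subst, VarsBelow]
    constructor <;> split_ifs
    exacts [hy, h.1, hy, h.2]
  | eqn e => exact fun _ => trivial
  | imp φ ψ ih₁ ih₂ => exact fun h => ⟨ih₁ h.1, ih₂ h.2⟩
  | neg φ ih => exact fun h => ih h
  | all z φ ih =>
    intro h
    simp only [Formula.subst]
    split_ifs
    exacts [⟨hx, h.2⟩, ⟨hx, h.2.switch hx hy⟩, ⟨h.1, ih h.2⟩]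

theorem notMem_freeVars_subst {x y : ℕ} (hxy : x ≠ y) (φ : Formula) :
    x ∉ (φ.subst x y).freeVars := by
  induction φ with
  | rel u A v =>
    simp only [subst, freeVars, Finset.mem_insert, Finset.mem_singleton, not_or]
    constructor <;> split_ifs <;> first | exact hxy | exact Ne.symm ‹_›
  | eqn e => simp [subst, freeVars]
  | imp φ ψ ih₁ ih₂ => simp [subst, freeVars, ih₁, ih₂]
  | neg φ ih => exact ih
  | all z φ ih =>
    simp only [subst]
    split_ifs <;> simp [freeVars, ih]

end Formula

open BForm

section Substitution

variable {n : ℕ} {Ψ : Set Equation} {S : Set (BForm n)} {φ ψ : BForm n} {x y z w : Fin n}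
  {A B : Pred}

/-- Substitution of `y` for `x`. -/
def BForm.subst (x y : Fin n) (φ : BForm n) : BForm n := ⟨φ.1.subst x y, φ.2.subst x.2 y.2⟩

theorem BForm.subst_rel (x y u v : Fin n) (A : Pred) :
    (rel u A v).subst x y = rel (if u = x then y else u) A (if v = x then y else v) := by
  apply Subtype.ext
  simp only [BForm.subst, rel, Formula.subst, Fin.ext_iff]
  congr 1 <;> split_ifs <;> rfl

theorem BForm.subst_imp (x y : Fin n) (φ ψ : BForm n) :
    (imp φ ψ).subst x y = imp (φ.subst x y) (ψ.subst x y) := rfl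

theorem BForm.subst_neg (x y : Fin n) (φ : BForm n) : (neg φ).subst x y = neg (φ.subst x y) := rfl

theorem Thm.leibniz (x y : Fin n) (φ : BForm n) :
    Thm n Ψ (imp (rel x Pred.id y) (imp φ (φ.subst x y))) :=
  of_isBasic (.leibniz x y φ.1)

/-- Instantiation is not an axiom. If the instance failed, Leibniz's law would refute `w id y`; as
`w` is free neither in the instance nor in the premise, this contradicts `∃ w (w id y)`. -/
theorem Entails.all_inst (hwy : w ≠ y) (h : Entails Ψ S (all w φ)) :
    Entails Ψ S (φ.subst w y) := by
  have key : Thm n Ψ (imp (all w φ) (φ.subst w y)) := by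
    refine (imp_intro (reductio ?_)).toThm
    refine absurd (φ := all w (neg (rel w Pred.id y))) (gen w ?_ (neg_intro ?_))
      (thm (.ex_eq hwy))
    · rintro ψ (rfl | rfl | h)
      · exact Formula.notMem_freeVars_subst (Fin.val_ne_of_ne hwy) φ.1
      · simp [NotFree, BForm.all, Formula.freeVars]
      · exact h.elim
    · exact absurd (mp (mp (thm (.leibniz w y φ)) mem_insert)
        (mp (thm (.all_elim w φ)) mem_insert.insert.insert)) mem_insert.insert
  exact mp (thm key) h

theorem Thm.subst (hwy : w ≠ y) (h : Thm n Ψ φ) : Thm n Ψ (φ.subst w y) :=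
  (Entails.all_inst hwy (.thm (h.gen w))).toThm

theorem Fin.exists_ne_ne (hn : 3 ≤ n) (x z : Fin n) : ∃ w, w ≠ x ∧ w ≠ z := by
  obtain ⟨w, hw⟩ := Finset.exists_mem_notMem_of_card_lt_card (s := {x, z}) (t := Finset.univ)
    (Finset.card_le_two.trans_lt (by rwa [Finset.card_univ, Fintype.card_fin]))
  exact ⟨w, by simpa using hw⟩

/-- A property of pairs of variables that is preserved when a variable of a pair with distinct
members is replaced holds for all pairs if it holds for one such pair. -/
theorem forall_pairs (hn : 3 ≤ n) {Q : Fin n → Fin n → Prop}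
    (hl : ∀ a b w, a ≠ b → Q a b → Q w b) (hr : ∀ a b w, a ≠ b → Q a b → Q a w)
    {a b : Fin n} (hab : a ≠ b) (h : Q a b) (x y : Fin n) : Q x y := by
  -- Only the last replacement may produce a diagonal pair. Pairs with second member `a` need a
  -- detour through a third variable.
  have hoff : ∀ u v, v ≠ a → Q u v := fun u v hv => hl a v u hv.symm (hr a b v hab h)
  by_cases hy : y = a
  · subst hy
    obtain ⟨w, hwy, hwb⟩ := Fin.exists_ne_ne hn y b
    exact hl w y x hwy (hr w b y hwb (hoff w b hab.symm))
  · exact hoff x y hy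

/-- The defining axioms speak of the variables 0 and 1 only. Variables are replaced one at a time
from distinct pairs, so that a substitution never affects both places. -/
theorem Thm.of_zero_one (hn : 3 ≤ n) {F : Fin n → Fin n → BForm n}
    (hl : ∀ a b w, a ≠ b → (F a b).subst a w = F w b)
    (hr : ∀ a b w, a ≠ b → (F a b).subst b w = F a w)
    (h : Thm n Ψ (F ⟨0, by omega⟩ ⟨1, by omega⟩)) (x y : Fin n) : Thm n Ψ (F x y) := by
  refine forall_pairs hn (Q := fun x y => Thm n Ψ (F x y)) (fun a b w hab h => ?_)
    (fun a b w hab h => ?_) (a := ⟨0, by omega⟩) (b := ⟨1, by omega⟩) (by simp) h x y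
  · by_cases haw : a = w
    · exact haw ▸ h
    · exact hl a b w hab ▸ h.subst haw
  · by_cases hbw : b = w
    · exact hbw ▸ h
    · exact hr a b w hab ▸ h.subst hbw

theorem Entails.add_iff (hn : 3 ≤ n) :
    Entails Ψ S (rel x (Pred.add A B) y) ↔ Entails Ψ S (BForm.or (rel x A y) (rel x B y)) := by
  refine iff_congr (thm (Thm.of_zero_one hn
    (F := fun x y => iff (rel x (Pred.add A B) y) (BForm.or (rel x A y) (rel x B y)))
    ?_ ?_ (.of_isBasic (.def_add A B)) x y))
  all_goals
    intro a b w hab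
    simp [iff, BForm.or, subst_imp, subst_neg, subst_rel, hab, hab.symm]

theorem Entails.compl_iff (hn : 3 ≤ n) :
    Entails Ψ S (rel x (Pred.compl A) y) ↔ Entails Ψ S (neg (rel x A y)) := by
  refine iff_congr (thm (Thm.of_zero_one hn
    (F := fun x y => iff (rel x (Pred.compl A) y) (neg (rel x A y)))
    ?_ ?_ (.of_isBasic (.def_compl A)) x y))
  all_goals
    intro a b w hab
    simp [iff, subst_imp, subst_neg, subst_rel, hab, hab.symm]

theorem Entails.conv_iff (hn : 3 ≤ n) :
    Entails Ψ S (rel x (Pred.conv A) y) ↔ Entails Ψ S (rel y A x) := by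
  refine iff_congr (thm (Thm.of_zero_one hn
    (F := fun x y => iff (rel x (Pred.conv A) y) (rel y A x))
    ?_ ?_ (.of_isBasic (.def_conv A)) x y))
  all_goals
    intro a b w hab
    simp [iff, subst_imp, subst_neg, subst_rel, hab, hab.symm]

theorem Entails.mul_iff (hn : 3 ≤ n) :
    Entails Ψ S (rel x (Pred.mul A B) y) ↔ Entails Ψ S (rel x A y) ∧ Entails Ψ S (rel x B y) := by
  have h₁ : ∀ {T : Set (BForm n)} {C : Pred}, Entails Ψ T (neg (rel x (Pred.compl C) y)) ↔
      Entails Ψ T (rel x C y) := by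
    intro T C
    rw [neg_iff, iff_inconsistent]
    exact ⟨fun h => .of_entails ((compl_iff hn).2 mem_insert)
        (h.mono (Set.insert_subset_insert (Set.subset_insert _ _))),
      fun h => .of_entails ((compl_iff hn).1 mem_insert)
        (h.mono (Set.insert_subset_insert (Set.subset_insert _ _)))⟩
  rw [Pred.mul, compl_iff hn]
  constructor
  · refine fun h => ⟨h₁.1 (neg_intro ?_), h₁.1 (neg_intro ?_)⟩
    · exact absurd ((add_iff hn).2 (imp_intro (mem_insert.insert.absurd mem_insert _))) h.insert
    · exact absurd ((add_iff hn).2 (imp_intro mem_insert.insert)) h.insert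
  · rintro ⟨hA, hB⟩
    refine neg_intro (absurd (φ := rel x (Pred.compl B) y) ?_ (h₁.2 hB.insert))
    exact mp ((add_iff hn).1 mem_insert) (h₁.2 hA.insert)

/-- The definition of the relative product, for arbitrary variables. -/
def BForm.rpDef (A B : Pred) (x z y : Fin n) : BForm n :=
  iff (rel x (Pred.rp A B) z) (ex y (BForm.and (rel x A y) (rel y B z)))

theorem BForm.rpDef_subst_left (hxz : x ≠ z) (hyx : y ≠ x) (hyw : y ≠ w) :
    (rpDef A B x z y).subst x w = rpDef A B w z y := by
  apply Subtype.ext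
  simp [rpDef, iff, ex, BForm.and, BForm.subst, imp, neg, BForm.all, rel, Formula.subst,
    Fin.val_inj, hyx, hyw, hxz.symm]

theorem BForm.rpDef_subst_right (hxz : x ≠ z) (hyz : y ≠ z) (hyw : y ≠ w) :
    (rpDef A B x z y).subst z w = rpDef A B x w y := by
  apply Subtype.ext
  simp [rpDef, iff, ex, BForm.and, BForm.subst, imp, neg, BForm.all, rel, Formula.subst,
    Fin.val_inj, hyz, hyw, hxz]

/-- The new variable would be captured, so the substitution interchanges it with the old one, which
becomes the bound variable. -/
theorem BForm.rpDef_subst_left_bound (hxz : x ≠ z) (hyx : y ≠ x) (hyz : y ≠ z) :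
    (rpDef A B x z y).subst x y = rpDef A B y z x := by
  apply Subtype.ext
  simp [rpDef, iff, ex, BForm.and, BForm.subst, imp, neg, BForm.all, rel, Formula.subst,
    Formula.switch, Equiv.swap_apply_def, Fin.val_inj, hyx, hyz.symm, hxz.symm]

theorem BForm.rpDef_subst_right_bound (hxz : x ≠ z) (hyx : y ≠ x) (hyz : y ≠ z) :
    (rpDef A B x z y).subst z y = rpDef A B x y z := by
  apply Subtype.ext
  simp [rpDef, iff, ex, BForm.and, BForm.subst, imp, neg, BForm.all, rel, Formula.subst,
    Formula.switch, Equiv.swap_apply_def, Fin.val_inj, hyz, hyx.symm, hxz]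

theorem Entails.ex_rename (hyx : y ≠ x) (hyz : y ≠ z) (hwx : w ≠ x) (hwz : w ≠ z)
    (h : Entails Ψ S (ex y (BForm.and (rel x A y) (rel y B z)))) :
    Entails Ψ S (ex w (BForm.and (rel x A w) (rel w B z))) := by
  by_cases hwy : w = y
  · exact hwy ▸ h
  have key : Thm n Ψ (imp (all w (neg (BForm.and (rel x A w) (rel w B z))))
      (all y (neg (BForm.and (rel x A y) (rel y B z))))) := by
    refine (imp_intro (gen y ?_ ?_)).toThm
    · rintro ψ (rfl | h)
      · simp [NotFree, BForm.all, BForm.and, neg, imp, rel, Formula.freeVars, Fin.val_inj, hyx,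
          hyz, Ne.symm hwy]
      · exact h.elim
    · have := (mem_insert : Entails Ψ (Insert.insert
        (all w (neg (BForm.and (rel x A w) (rel w B z)))) ∅) _).all_inst hwy
      simpa [BForm.and, subst_neg, subst_imp, subst_rel, hwx.symm, hwz.symm] using this
  exact neg_intro (absurd (mp (thm key) mem_insert) h.insert)

/-- Since capture may change the bound variable, the definition is first moved to `x, z` with some
bound variable, which is renamed at the end. -/
theorem Thm.rpDef (hn : 3 ≤ n) (x z y : Fin n) (hyx : y ≠ x) (hyz : y ≠ z) :
    Thm n Ψ (rpDef A B x z y) := by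
  have rename : ∀ {x z y w : Fin n}, y ≠ x → y ≠ z → w ≠ x → w ≠ z →
      Thm n Ψ (BForm.rpDef A B x z y) → Thm n Ψ (BForm.rpDef A B x z w) := by
    intro x z y w hyx hyz hwx hwz h
    have h₁ : ∀ {S : Set (BForm n)}, Entails Ψ S (rel x (Pred.rp A B) z) ↔
        Entails Ψ S (ex w (BForm.and (rel x A w) (rel w B z))) := fun {S} =>
      (Entails.iff_congr (.thm h)).trans ⟨.ex_rename hyx hyz hwx hwz, .ex_rename hwx hwz hyx hyz⟩
    exact (Entails.and_iff.2 ⟨.imp_intro (h₁.1 .mem_insert), .imp_intro (h₁.2 .mem_insert)⟩).toThm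
  obtain ⟨w, hwx, hwz, h⟩ : ∃ y, y ≠ x ∧ y ≠ z ∧ Thm n Ψ (BForm.rpDef A B x z y) := by
    refine forall_pairs hn (Q := fun x z => ∃ y, y ≠ x ∧ y ≠ z ∧ Thm n Ψ (BForm.rpDef A B x z y))
      ?_ ?_ (a := ⟨0, by omega⟩) (b := ⟨1, by omega⟩) (by simp)
      ⟨⟨2, by omega⟩, by simp, by simp, .of_isBasic (.def_rp A B)⟩ x z
    · rintro a b w hab ⟨y, hya, hyb, h⟩
      by_cases haw : a = w
      · exact haw ▸ ⟨y, hya, hyb, h⟩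
      by_cases hyw : y = w
      · subst hyw
        exact ⟨a, haw, hab, rpDef_subst_left_bound hab hya hyb ▸ h.subst haw⟩
      · exact ⟨y, hyw, hyb, rpDef_subst_left hab hya hyw ▸ h.subst haw⟩
    · rintro a b w hab ⟨y, hya, hyb, h⟩
      by_cases hbw : b = w
      · exact hbw ▸ ⟨y, hya, hyb, h⟩
      by_cases hyw : y = w
      · subst hyw
        exact ⟨b, hab.symm, hbw, rpDef_subst_right_bound hab hya hyb ▸ h.subst hbw⟩
      · exact ⟨y, hya, hyw, rpDef_subst_right hab hyb hyw ▸ h.subst hbw⟩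
  exact rename hwx hwz hyx hyz h

/-- The midpoint `y` may equal `x` or `z`, where the definition cannot bind it; a distinct `w` is
bound and instantiated by `y`. -/
theorem Entails.rp_intro (hn : 3 ≤ n) (h₁ : Entails Ψ S (rel x A y))
    (h₂ : Entails Ψ S (rel y B z)) :
    Entails Ψ S (rel x (Pred.rp A B) z) := by
  obtain ⟨w, hwx, hwz⟩ := Fin.exists_ne_ne hn x z
  refine (iff_congr (thm (.rpDef hn x z w hwx hwz))).2 (neg_intro ?_)
  refine absurd (and_iff.2 ⟨h₁, h₂⟩).insert ?_
  by_cases hwy : w = y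
  · subst hwy
    exact mp (thm (.all_elim w _)) mem_insert
  · have := (mem_insert : Entails Ψ (Insert.insert
      (all w (neg (BForm.and (rel x A w) (rel w B z)))) S) _).all_inst hwy
    simpa [BForm.and, subst_neg, subst_imp, subst_rel, hwx.symm, hwz.symm] using this

theorem Entails.rp_elim (hn : 3 ≤ n) (hyx : y ≠ x) (hyz : y ≠ z) (hS : ∀ ψ ∈ S, NotFree y ψ)
    (h : Inconsistent Ψ (Insert.insert (rel x A y) (Insert.insert (rel y B z) S))) :
    Inconsistent Ψ (Insert.insert (rel x (Pred.rp A B) z) S) := by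
  have h₁ := (iff_congr (thm (.rpDef hn x z y hyx hyz))).1
    (mem_insert (Ψ := Ψ) (S := S) (φ := rel x (Pred.rp A B) z))
  refine absurd (gen y hS (neg_intro ?_)).insert h₁
  have h₂ := and_iff.1 (mem_insert (Ψ := Ψ) (S := S) (φ := BForm.and (rel x A y) (rel y B z)))
  refine .of_entails h₂.2 (.of_entails h₂.1.insert (h.mono ?_))
  exact Set.insert_subset_insert (Set.insert_subset_insert (Set.subset_insert _ _))

theorem Thm.id_refl (hn : 3 ≤ n) (x : Fin n) : Thm n Ψ (rel x Pred.id x) := by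
  obtain ⟨w, hwx, -⟩ := Fin.exists_ne_ne hn x x
  refine (Entails.reductio ?_).toThm
  refine Entails.absurd (.gen w ?_ (.neg_intro ?_)) (.thm (.ex_eq hwx))
  · rintro ψ (rfl | h)
    · simp [NotFree, neg, rel, Formula.freeVars, Fin.val_inj, hwx]
    · exact h.elim
  -- Leibniz's law applied to `w id x` itself turns it into `x id x`.
  · have := Entails.mp (.mp (.thm (.leibniz w x (rel w Pred.id x))) .mem_insert)
      (.mem_insert (Ψ := Ψ) (S := insert (neg (rel x Pred.id x)) ∅))
    rw [subst_rel, if_pos rfl, if_neg hwx.symm] at this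
    exact this.absurd (.mem (by simp))

theorem Entails.id_snd (hn : 3 ≤ n) (h₁ : Entails Ψ S (rel x A y))
    (h₂ : Entails Ψ S (rel y Pred.id z)) : Entails Ψ S (rel x A z) := by
  have key : ∀ {w}, w ≠ y → Thm n Ψ (imp (rel y Pred.id z) (imp (rel w A y) (rel w A z))) := by
    intro w hw
    have := Thm.leibniz (Ψ := Ψ) y z (rel w A y)
    rwa [subst_rel, if_neg hw, if_pos rfl] at this
  by_cases hxy : x = y
  · subst hxy
    by_cases hxz : x = z
    · exact hxz ▸ h₁
    -- Leibniz's law would rewrite both places of `x A x`. It is applied to `w A x` instead, and `x`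
    -- is substituted for `w` afterwards.
    obtain ⟨w, hwx, hwz⟩ := Fin.exists_ne_ne hn x z
    have := (key hwx).subst hwx
    simp only [subst_imp, subst_rel, hwx.symm, hwz.symm, if_true, if_false] at this
    exact mp (mp (thm this) h₂) h₁
  · exact mp (mp (thm (key hxy)) h₂) h₁

end Substitution

/-! ### Soundness of the sequent calculus for the finite-variable formalism -/

open BForm Entails

section Soundness

variable {m n : ℕ} {Ψ : Set Equation}

/-- The formula of the `n`-variable formalism given by a formula with `m ≤ n` variables. -/
def atomForm (h : m ≤ n) (a : Atom m) : BForm n := rel (a.1.castLE h) a.2.1 (a.2.2.castLE h)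

/-- The formulas that a sequent refutes: those on the left and the negations of those on the
right. -/
def sequentForms (h : m ≤ n) (Γ Δ : Set (Atom m)) : Set (BForm n) :=
  atomForm h '' Γ ∪ (fun a => neg (atomForm h a)) '' Δ

variable {h : m ≤ n} {Γ Δ Γ' Δ' : Set (Atom m)}

theorem sequentForms_insert_left (a : Atom m) :
    sequentForms h (insert a Γ) Δ = insert (atomForm h a) (sequentForms h Γ Δ) := by
  simp [sequentForms, Set.image_insert_eq, Set.insert_union]

theorem sequentForms_insert_right (a : Atom m) :
    sequentForms h Γ (insert a Δ) = insert (neg (atomForm h a)) (sequentForms h Γ Δ) := by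
  simp [sequentForms, Set.image_insert_eq, Set.union_insert]

theorem sequentForms_mono (hΓ : Γ ⊆ Γ') (hΔ : Δ ⊆ Δ') :
    sequentForms h Γ Δ ⊆ sequentForms h Γ' Δ' :=
  Set.union_subset_union (Set.image_mono hΓ) (Set.image_mono hΔ)

theorem notFree_sequentForms {y : Fin m} (hΓ : NotIn y Γ) (hΔ : NotIn y Δ) :
    ∀ ψ ∈ sequentForms h Γ Δ, NotFree (y.castLE h) ψ := by
  rintro _ (⟨a, ha, rfl⟩ | ⟨a, ha, rfl⟩)
  · have := hΓ a ha
    simp [NotFree, atomForm, rel, Formula.freeVars, Fin.val_inj, this.1.symm, this.2.symm]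
  · have := hΔ a ha
    simp [NotFree, atomForm, neg, rel, Formula.freeVars, Fin.val_inj, this.1.symm, this.2.symm]

/-- Reading sequents as inconsistent sets allows infinite sides without forming infinite
disjunctions. Proofs with fewer than three variables are interpreted with `n ≥ 3`, where the
definition of `;` is available. -/
theorem SeqProvable.inconsistent (hn : 3 ≤ n) (hmn : m ≤ n) {Φ : Set (Sequent m)}
    (hΦ : ∀ s ∈ Φ, Inconsistent Ψ (sequentForms hmn s.left s.right)) (hp : SeqProvable Φ Γ Δ) :
    Inconsistent Ψ (sequentForms hmn Γ Δ) := by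
  have hl : ∀ {Γ Δ Γ' Δ' : Set (Atom m)}, sequentForms hmn Γ Δ ⊆
      sequentForms hmn (Γ ∪ Γ') (Δ ∪ Δ') := by
    intro _ _ _ _
    exact sequentForms_mono Set.subset_union_left Set.subset_union_left
  have hr : ∀ {Γ Δ Γ' Δ' : Set (Atom m)}, sequentForms hmn Γ' Δ' ⊆
      sequentForms hmn (Γ ∪ Γ') (Δ ∪ Δ') := by
    intro _ _ _ _
    exact sequentForms_mono Set.subset_union_right Set.subset_union_right
  induction hp with
  | hyp s hs => exact hΦ s hs
  | ax a Γ Δ h h' =>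
    exact absurd (mem (.inl (Set.mem_image_of_mem _ h))) (mem (.inr (Set.mem_image_of_mem _ h')))
  | id_right x Γ Δ h =>
    exact absurd (thm (.id_refl hn (x.castLE hmn))) (mem (.inr (Set.mem_image_of_mem _ h)))
  | cut a Γ Δ Γ' Δ' _ _ ih₁ ih₂ =>
    rw [sequentForms_insert_right] at ih₁
    rw [sequentForms_insert_left] at ih₂
    exact .of_entails ((reductio ih₁).mono hl) (ih₂.mono (Set.insert_subset_insert hr))
  | id_left x y z A Γ Δ _ ih =>
    rw [sequentForms_insert_left] at ih
    rw [sequentForms_insert_left, sequentForms_insert_left]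
    exact .of_entails (Entails.id_snd hn (mem_insert) mem_insert.insert)
      (ih.mono (Set.insert_subset_insert
        ((Set.subset_insert _ _).trans (Set.subset_insert _ _))))
  | add_left x y A B Γ Δ Γ' Δ' _ _ ih₁ ih₂ =>
    rw [sequentForms_insert_left] at ih₁ ih₂
    rw [sequentForms_insert_left]
    exact .of_entails (mp ((add_iff hn).1 mem_insert) ((neg_intro ih₁).mono hl).insert)
      (ih₂.mono (Set.insert_subset_insert (hr.trans (Set.subset_insert _ _))))
  | add_right x y A B Γ Δ _ ih =>
    rw [sequentForms_insert_right, sequentForms_insert_right] at ih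
    rw [sequentForms_insert_right]
    refine absurd ((add_iff hn).2 (imp_intro (reductio ?_))).insert mem_insert
    rw [Set.insert_comm]
    exact ih
  | mul_left x y A B Γ Δ _ ih =>
    rw [sequentForms_insert_left, sequentForms_insert_left] at ih
    rw [sequentForms_insert_left]
    have hm := (mul_iff hn).1 (mem_insert (Ψ := Ψ)
      (φ := atomForm hmn (x, Pred.mul A B, y)) (S := sequentForms hmn Γ Δ))
    exact .of_entails hm.2 (.of_entails hm.1.insert (ih.mono
      (Set.insert_subset_insert (Set.insert_subset_insert (Set.subset_insert _ _)))))
  | mul_right x y A B Γ Δ Γ' Δ' _ _ ih₁ ih₂ =>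
    rw [sequentForms_insert_right] at ih₁ ih₂
    rw [sequentForms_insert_right]
    exact absurd ((mul_iff hn).2 ⟨(reductio ih₁).mono hl, (reductio ih₂).mono hr⟩).insert
      mem_insert
  | compl_left x y A Γ Δ _ ih =>
    rw [sequentForms_insert_right] at ih
    rw [sequentForms_insert_left]
    exact absurd (reductio ih).insert ((compl_iff hn).1 mem_insert)
  | compl_right x y A Γ Δ _ ih =>
    rw [sequentForms_insert_left] at ih
    rw [sequentForms_insert_right]
    exact absurd ((compl_iff hn).2 (neg_intro ih)).insert mem_insert
  | rp_left x y z A B Γ Δ hx hz hΓ hΔ _ ih =>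
    rw [sequentForms_insert_left, sequentForms_insert_left] at ih
    rw [sequentForms_insert_left]
    exact rp_elim hn (y := y.castLE hmn) (by simpa [Fin.ext_iff] using hx)
      (by simpa [Fin.ext_iff] using hz) (notFree_sequentForms hΓ hΔ) ih
  | rp_right x y z A B Γ Δ Γ' Δ' _ _ ih₁ ih₂ =>
    rw [sequentForms_insert_right] at ih₁ ih₂
    rw [sequentForms_insert_right]
    exact absurd (rp_intro hn ((reductio ih₁).mono hl) ((reductio ih₂).mono hr)).insert mem_insert
  | conv_left x y A Γ Δ _ ih =>
    rw [sequentForms_insert_left] at ih ⊢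
    exact .of_entails ((conv_iff hn).1 mem_insert)
      (ih.mono (Set.insert_subset_insert (Set.subset_insert _ _)))
  | conv_right x y A Γ Δ _ ih =>
    rw [sequentForms_insert_right] at ih ⊢
    exact absurd ((conv_iff hn).2 (reductio ih)).insert mem_insert

end Soundness

/-! ### From sequent proofs to membership in the logics -/

section Logics

variable {n : ℕ} {Ψ Ψ' : Set Equation} {A B : Pred}

theorem thm_eqn_iff (hn : 3 ≤ n) : FOProvable n Ψ (Formula.eqn ⟨A, B⟩) ↔
    Thm n Ψ (iff (rel ⟨0, by omega⟩ A ⟨1, by omega⟩) (rel ⟨0, by omega⟩ B ⟨1, by omega⟩)) := by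
  set χ : BForm n := iff (rel ⟨0, by omega⟩ A ⟨1, by omega⟩) (rel ⟨0, by omega⟩ B ⟨1, by omega⟩)
  have hdef : Thm n Ψ (iff (eqn ⟨A, B⟩) ⟨χ.1.closure, χ.2.closure⟩) := by
    rw [Thm, Formula.closure_of_closed]
    · exact .basic _ (.def_eqn A B) (BForm.iff (eqn ⟨A, B⟩) ⟨χ.1.closure, χ.2.closure⟩).2
    · simp [iff, eqn, imp, neg, Formula.freeVars, Formula.freeVars_closure]
  have h := iff_congr (thm (S := ∅) hdef)
  have hcl : ∀ φ : BForm n, φ.1.freeVars = ∅ → (FOProvable n Ψ φ.1 ↔ Entails Ψ ∅ φ) := by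
    intro φ hφ
    rw [show FOProvable n Ψ φ.1 ↔ Thm n Ψ φ by rw [Thm, Formula.closure_of_closed hφ]]
    exact ⟨thm, toThm⟩
  exact (hcl (eqn ⟨A, B⟩) rfl).trans (h.trans (hcl _ (Formula.freeVars_closure _)).symm)

/-- Membership in a logic in terms of provability of the formula `x A x`. -/
theorem mem_CT_iff (hn : 3 ≤ n) (x : Fin n) : A ∈ CT n Ψ ↔ Thm n Ψ (rel x A x) := by
  refine (thm_eqn_iff hn).trans ⟨fun h => ?_, fun h => ?_⟩
  · have h₁ : Thm n Ψ (iff (rel x (Pred.add Pred.id A) x) (rel x A x)) := by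
      refine Thm.of_zero_one hn
        (F := fun x y => iff (rel x (Pred.add Pred.id A) y) (rel x A y)) ?_ ?_ h x x
      all_goals
        intro a b w hab
        simp [iff, subst_imp, subst_neg, subst_rel, hab, hab.symm]
    have h₂ := iff_congr (thm (S := ∅) h₁)
    refine (h₂.1 ((add_iff hn).2 (imp_intro ?_))).toThm
    exact absurd (thm (.id_refl hn x)) mem_insert _
  -- From `0 A 0` and `0 id 1`, the identity yields `0 A 1`, which is the inclusion of `id` in `A`.
  · have h₀ : Thm n Ψ (rel ⟨0, by omega⟩ A ⟨0, by omega⟩) := by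
      by_cases hx : x = ⟨0, by omega⟩
      · exact hx ▸ h
      · have := h.subst hx
        rwa [subst_rel, if_pos rfl] at this
    refine (and_iff.2
      ⟨imp_intro ?_, imp_intro ((add_iff hn).2 (imp_intro mem_insert.insert))⟩).toThm
    refine reductio (absurd (φ := rel ⟨0, by omega⟩ A ⟨1, by omega⟩) ?_ mem_insert)
    exact Entails.id_snd hn (thm h₀) (reductio (absurd
      (mp ((add_iff hn).1 mem_insert.insert.insert) mem_insert) mem_insert.insert))

theorem mem_CT_of_seqProvable {m : ℕ} [NeZero m] (hn : 3 ≤ n) (hmn : m ≤ n) {Φ : Set (Sequent m)}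
    (hΦ : ∀ s ∈ Φ, Inconsistent Ψ (sequentForms hmn s.left s.right))
    (h : SeqProvable Φ (assertion m A).left (assertion m A).right) : A ∈ CT n Ψ := by
  rw [mem_CT_iff hn ((0 : Fin m).castLE hmn)]
  refine (reductio ((h.inconsistent hn hmn hΦ).mono ?_)).toThm
  simp [sequentForms, assertion, atomForm]

theorem NProvable.mem_CT {m : ℕ} [NeZero m] (hn : 3 ≤ n) (hmn : m ≤ n) (h : NProvable m A) :
    A ∈ CT n Ψ :=
  mem_CT_of_seqProvable hn hmn (by simp) h

theorem NProvableFrom.mem_CT {m : ℕ} [NeZero m] (hm : 2 ≤ m) (hn : 3 ≤ n) (hmn : m ≤ n)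
    (hΨ : Ψ' ⊆ Ψ) (h : NProvableFrom m Ψ' A) : A ∈ CT n Ψ := by
  refine mem_CT_of_seqProvable hn hmn ?_ h
  rintro s ⟨e, he, hs⟩
  have h₀ : (0 : Fin m).castLE hmn = ⟨0, by omega⟩ := rfl
  -- For `m = 1` the numeral 1 would denote the variable 0; hence `2 ≤ m`.
  have h₁ : (1 : Fin m).castLE hmn = ⟨1, by omega⟩ :=
    Fin.ext (by simp [Nat.mod_eq_of_lt hm])
  have heq := fun S => iff_congr (thm (S := S)
    ((thm_eqn_iff hn (A := e.lhs) (B := e.rhs)).1 (FOProvable.hyp e (hΨ he))))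
  rcases hs with rfl | rfl
  · refine absurd (φ := atomForm hmn (0, e.rhs, 1)) ?_ (mem (by simp [sequentForms]))
    simp only [atomForm, h₀, h₁]
    exact (heq _).1 (mem (by simp [sequentForms, atomForm, h₀, h₁]))
  · refine absurd (φ := atomForm hmn (0, e.lhs, 1)) ?_ (mem (by simp [sequentForms]))
    simp only [atomForm, h₀, h₁]
    exact (heq _).2 (mem (by simp [sequentForms, atomForm, h₀, h₁]))

/-- A premise in the logic makes its assertion an inconsistent sequent for the enlarged assumptions,
so soundness applies with the premises as extra axioms. -/
theorem RuleNProvable.isRuleOf {m : ℕ} [NeZero m] (hn : 3 ≤ n) (hmn : m ≤ n) {r : Rule}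
    (h : RuleNProvable m r) : IsRuleOf n Ψ r := by
  intro Ψ' _ hP
  refine mem_CT_of_seqProvable hn hmn ?_ h
  rintro s ⟨P, hP', rfl⟩
  exact absurd (thm ((mem_CT_iff hn ((0 : Fin m).castLE hmn)).1 (hP P hP')))
    (mem (by simp [sequentForms, assertion, atomForm]))

end Logics

theorem mem_CT_of_mem_predsCT3 {n : ℕ} (hn : 3 ≤ n) (Ψ : Set Equation) (A B C D : Pred) :
    ∀ P ∈ predsCT3 A B C D, P ∈ CT n Ψ := by
  intro P hP
  simp only [predsCT3, List.mem_append] at hP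
  rcases hP with (hP | hP) | hP
  · exact (nProvable_preds1 A P hP).mem_CT hn (by omega)
  · exact (nProvable_preds2 A B C P hP).mem_CT hn (by omega)
  · exact (nProvable_preds3 A B C D P hP).mem_CT hn (by omega)

theorem mem_CT_of_mem_preds4 {n : ℕ} (hn : 4 ≤ n) (Ψ : Set Equation) (A B C : Pred) :
    ∀ P ∈ preds4 A B C, P ∈ CT n Ψ :=
  fun P hP => (nProvable_preds4 A B C P hP).mem_CT (by omega) hn

theorem mem_TR_of_mem_predsTR (A B C : Pred) : ∀ P ∈ predsTR A B C, P ∈ TR := by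
  intro P hP
  simp only [predsTR, List.mem_append, List.mem_singleton] at hP
  rcases hP with (((hP | hP) | hP) | hP) | rfl
  · exact (nProvableFrom_predsDensity3 A B P hP).mem_CT (by omega) (by omega) (by omega)
      Set.subset_union_left
  · exact (nProvableFrom_predsDensity4 A B C P hP).mem_CT (by omega) (by omega) (by omega)
      Set.subset_union_left
  · exact (nProvableFrom_predsComm3 A B P hP).mem_CT (by omega) (by omega) (by omega)
      Set.subset_union_right
  · exact (nProvableFrom_predsComm4 A B C P hP).mem_CT (by omega) (by omega) (by omega)
      Set.subset_union_right
  · exact (nProvableFrom_selfDist A B C).mem_CT (by omega) (by omega) (by omega) subset_rfl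

theorem isRuleOf_of_mem_allRules {n : ℕ} (hn : 3 ≤ n) (Ψ : Set Equation) (A B C D : Pred) :
    ∀ r ∈ allRules A B C D, IsRuleOf n Ψ r := by
  intro r hr
  simp only [allRules, List.mem_append] at hr
  rcases hr with (hr | hr) | hr
  · exact (ruleNProvable_rules1 A B r hr).isRuleOf hn (by omega)
  · exact (ruleNProvable_rules2 A B C r hr).isRuleOf hn (by omega)
  · exact (ruleNProvable_rules3 A B C D r hr).isRuleOf hn (by omega)

end RelLogic

theorem theorem11 (A B C D : Pred) :
    (∀ P ∈ preds1 A, NProvable 1 P) ∧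
    (∀ P ∈ preds2 A B C, NProvable 2 P) ∧
    (∀ P ∈ preds3 A B C D, NProvable 3 P) ∧
    (∀ r ∈ rules1 A B, RuleNProvable 1 r) ∧
    (∀ r ∈ rules2 A B C, RuleNProvable 2 r) ∧
    (∀ r ∈ rules3 A B C D, RuleNProvable 3 r) ∧
    (∀ P ∈ preds4 A B C, NProvable 4 P) ∧
    (∀ P ∈ predsDensity3 A B, NProvableFrom 3 density P) ∧
    (∀ P ∈ predsDensity4 A B C, NProvableFrom 4 density P) ∧
    (∀ P ∈ predsComm3 A B, NProvableFrom 3 commutativity P) ∧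
    (∀ P ∈ predsComm4 A B C, NProvableFrom 4 commutativity P) ∧
    NProvableFrom 4 (density ∪ commutativity) (selfDist A B C) ∧
    NProvableFrom 2 symmetry (A ⋏ ∼A ⇾ B) ∧
    NProvableFrom 3 symmetry (A ⊚ B ⇾ B ⊚ A) ∧
    (∀ P ∈ predsCT3 A B C D, P ∈ CT 3 ∅) ∧
    (∀ r ∈ allRules A B C D, IsRuleOf 3 ∅ r) ∧
    (∀ P ∈ predsCT3 A B C D ++ preds4 A B C, P ∈ CT 4 ∅) ∧
    (∀ r ∈ allRules A B C D, IsRuleOf 4 ∅ r) ∧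
    (∀ P ∈ predsCT3 A B C D ++ preds4 A B C ++ predsTR A B C, P ∈ TR) ∧
    (∀ r ∈ allRules A B C D, IsRuleOf 4 assumptionsTR r) :=
  ⟨nProvable_preds1 A, nProvable_preds2 A B C, nProvable_preds3 A B C D, ruleNProvable_rules1 A B,
    ruleNProvable_rules2 A B C, ruleNProvable_rules3 A B C D, nProvable_preds4 A B C,
    nProvableFrom_predsDensity3 A B, nProvableFrom_predsDensity4 A B C,
    nProvableFrom_predsComm3 A B, nProvableFrom_predsComm4 A B C, nProvableFrom_selfDist A B C,
    nProvableFrom_symmetry2 A B, nProvableFrom_symmetry3 A B,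
    mem_CT_of_mem_predsCT3 le_rfl ∅ A B C D, isRuleOf_of_mem_allRules le_rfl ∅ A B C D,
    List.forall_mem_append.2 ⟨mem_CT_of_mem_predsCT3 (by omega) ∅ A B C D,
      mem_CT_of_mem_preds4 le_rfl ∅ A B C⟩,
    isRuleOf_of_mem_allRules (by omega) ∅ A B C D,
    List.forall_mem_append.2 ⟨List.forall_mem_append.2
      ⟨mem_CT_of_mem_predsCT3 (by omega) assumptionsTR A B C D,
        mem_CT_of_mem_preds4 le_rfl assumptionsTR A B C⟩, mem_TR_of_mem_predsTR A B C⟩,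
    isRuleOf_of_mem_allRules (by omega) assumptionsTR A B C D⟩
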